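/- Consider randomized adaptive algorithms that have access to an unknown simple undirected graph $G$ on the vertex set $[n]$ ($n$ is known, the edge set and the number of edges are not) through three kinds of queries: a degree query on a vertex $v$ returns $\deg(v)$; a neighbor query on $v$ returns a fresh uniformly random neighbor of $v$, or a special symbol if $v$ has none; an independent-set (IS) query on $U\subseteq[n]$ returns whether $U$ is an independent set of $G$. For every $\varepsilon_0<1$ there is a constant $c=c(\varepsilon_0)>0$ such that the following holds for all $\varepsilon\in(0,\varepsilon_0]$ and all $n$. Let $\mathcal A$ be any such algorithm which, on every graph $G=([n],E)$, outputs with probability at least $2/3$ a number $\widehat m$ with $(1-\varepsilon)|E|\le\widehat m\le(1+\varepsilon)|E|$. Then for every integer $m$ with $1\le m\le\binom n2$ there is a graph $G$ on $[n]$ with exactly $m$ edges on which the expected number of queries made by $\mathcal A$ is at least \[ c\cdot\min\left(\sqrt m,\ \sqrt{\frac{n}{\varepsilon\sqrt m}}\right). \] -/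

import Mathlib

open scoped ENNReal

namespace HybridModel

/-- A query to a hidden graph on the vertex set `Fin n`. -/
inductive Query (n : ℕ) : Type
  /-- ask for the degree of `v` -/
  | deg (v : Fin n) : Query n
  /-- ask for a uniformly random neighbor of `v` -/
  | neigh (v : Fin n) : Query n
  /-- ask whether `S` is an independent set -/
  | indep (S : Finset (Fin n)) : Query n

/-- An answer to a query. The answer `neigh none` to a neighbor query signifies that the vertex
has no neighbors. -/
inductive Answer (n : ℕ) : Type
  | deg (d : ℕ) : Answer n
  | neigh (v : Option (Fin n)) : Answer n
  | indep (b : Bool) : Answer n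

/-- The finite set of queries carries the discrete sigma-algebra. -/
instance instMeasurableSpaceQuery (n : ℕ) : MeasurableSpace (Query n) := ⊤

open Classical in
/-- The law of a uniformly random neighbor of `v` in `G` (`none` if `v` is isolated). -/
noncomputable def randomNeighbor {n : ℕ} (G : SimpleGraph (Fin n)) (v : Fin n) :
    PMF (Option (Fin n)) :=
  if h : (G.neighborFinset v).Nonempty then
    (PMF.uniformOfFinset (G.neighborFinset v) h).map some
  else PMF.pure none

open Classical in
/-- The law of the oracle's answer to a query, for the hidden graph `G`. Degree and independent
set queries are answered deterministically; each neighbor query is answered by a fresh sample. -/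
noncomputable def oracle {n : ℕ} (G : SimpleGraph (Fin n)) : Query n → PMF (Answer n)
  | .deg v => PMF.pure (.deg (G.degree v))
  | .neigh v => (randomNeighbor G v).map Answer.neigh
  | .indep S => PMF.pure (.indep (decide (G.IsIndepSet (S : Set (Fin n)))))

/-- The history of an execution: the queries made so far with their answers, in order. -/
abbrev History (n : ℕ) : Type := List (Query n × Answer n)

/-- An adaptive deterministic query algorithm: given the history it either makes a further query
(`Sum.inl`) or halts and outputs a real number (`Sum.inr`). It need not always halt. -/
abbrev DetAlg (n : ℕ) : Type := History n → Query n ⊕ ℝ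

/-- The law of the history of `A` on the hidden graph `G` after `t` rounds; in each round an
algorithm that has not halted makes one query. -/
noncomputable def run {n : ℕ} (A : DetAlg n) (G : SimpleGraph (Fin n)) : ℕ → PMF (History n)
  | 0 => PMF.pure []
  | t + 1 => (run A G t).bind fun h =>
      match A h with
      | .inl q => (oracle G q).map fun a => h ++ [(q, a)]
      | .inr _ => PMF.pure h

/-- The expected number of queries of a deterministic algorithm on `G` (over the randomness of the
neighbor oracle): the limit of the expected number of queries made in the first `t` rounds, which
is nondecreasing in `t`. -/
noncomputable def DetAlg.expectedQueries {n : ℕ} (A : DetAlg n) (G : SimpleGraph (Fin n)) :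
    ℝ≥0∞ :=
  ⨆ t : ℕ, ∑' h : History n, run A G t h * (h.length : ℝ≥0∞)

/-- The probability (over the randomness of the neighbor oracle) that a deterministic algorithm
halts on `G` with an output in `S`: the limit of the probabilities that it has done so within the
first `t` rounds, which are nondecreasing in `t`. -/
noncomputable def DetAlg.probOutput {n : ℕ} (A : DetAlg n) (G : SimpleGraph (Fin n))
    (S : Set ℝ) : ℝ≥0∞ :=
  ⨆ t : ℕ, (run A G t).toOuterMeasure {h | ∃ x ∈ S, A h = Sum.inr x}

/-- A randomized query algorithm with random seed in `Ω`: for every seed a deterministic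
algorithm, each of whose decisions depends measurably on the seed. -/
structure RandAlg (n : ℕ) (Ω : Type*) [MeasurableSpace Ω] where
  toDet : Ω → DetAlg n
  measurable_toDet : ∀ h : History n, Measurable fun ω => toDet ω h

/-- The expected number of queries on `G`, over the seed (with law `μ`) and, independently of it,
the randomness of the neighbor oracle. -/
noncomputable def RandAlg.expectedQueries {n : ℕ} {Ω : Type*} [MeasurableSpace Ω]
    (A : RandAlg n Ω) (μ : MeasureTheory.Measure Ω) (G : SimpleGraph (Fin n)) : ℝ≥0∞ :=
  ∫⁻ ω, (A.toDet ω).expectedQueries G ∂μ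

/-- The probability of halting on `G` with an output in `S`, over the seed (with law `μ`) and,
independently of it, the randomness of the neighbor oracle. -/
noncomputable def RandAlg.probOutput {n : ℕ} {Ω : Type*} [MeasurableSpace Ω]
    (A : RandAlg n Ω) (μ : MeasureTheory.Measure Ω) (G : SimpleGraph (Fin n))
    (S : Set ℝ) : ℝ≥0∞ :=
  ∫⁻ ω, (A.toDet ω).probOutput G S ∂μ

/-- On every graph with vertex set `Fin n`, the algorithm outputs, with probability at least
`2 / 3`, a number within a factor `1 ± ε` of the number of edges. -/
def RandAlg.EstimatesEdges {n : ℕ} {Ω : Type*} [MeasurableSpace Ω]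
    (A : RandAlg n Ω) (μ : MeasureTheory.Measure Ω) (ε : ℝ) : Prop :=
  ∀ G : SimpleGraph (Fin n),
    2 / 3 ≤ A.probOutput μ G
      (Set.Icc ((1 - ε) * (G.edgeSet.ncard : ℝ)) ((1 + ε) * (G.edgeSet.ncard : ℝ)))

end HybridModel

/-! The proof is an averaging argument in the spirit of Yao's principle. Suppose that the correct
outputs for `G i` and for `G' i` are disjoint for every `i`. Within `q` rounds a successful
algorithm must either be still running or have made a query whose answer has different laws on the
two graphs. The two success probabilities add up to at least 4/3, so if such a query occurs with
average probability at most 1/12, then on some `G i` the algorithm is still running with probability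
at least 1/4, which costs `(q + 1) / 4` queries on average (`RandAlg.exists_le_expectedQueries`).
Here `q` is a small multiple of the claimed bound, and `k + 1` is the size of the largest clique
with at most `m` edges, so `√m ≤ k + 1`.

If `n < 6 * (k + 1)`, take one graph with `m` edges that contains a clique on `k + 1` vertices, cut
the clique vertices into `12 * q` disjoint parts, and delete all edges inside one part. Every query
notices the deletion for at most one choice of the part (`ncard_oracle_removePart_le_one`).

If `n ≥ 6 * (k + 1)`, hide a clique by choosing one random vertex in each of `k + 1` blocks of size
`b`, and add a matching to reach `m` edges. The second graph also joins a random class of `t` block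
vertices completely to a random class of `l` vertices outside the blocks and the matching. To notice
this, the algorithm must ask about a vertex of the second class, or expose a vertex of the first one
by a degree or neighbor query or inside a set found to be independent. An independent set contains
at most one clique vertex, so `q` queries expose at most `q` of them. A fixed set of `12 * q * b`
block vertices meets so few clique vertices with probability exponentially small in `q`. Once the
random choices of the neighbor oracle and the clique vertices they select are fixed, each answer is
one bit, and a union bound over `2 ^ q` histories shows that few vertices are exposed
(`card_many_exposed_le`). -/

namespace HybridModel

/-! ### Runs on two graphs and the queries that tell them apart. -/

section Histories

variable {n : ℕ} {A : DetAlg n} {G G' : SimpleGraph (Fin n)}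

/-- The law of the history after one further round. -/
noncomputable def stepLaw (A : DetAlg n) (G : SimpleGraph (Fin n)) (h : History n) :
    PMF (History n) :=
  match A h with
  | .inl q => (oracle G q).map fun a => h ++ [(q, a)]
  | .inr _ => PMF.pure h

theorem run_succ (t : ℕ) : run A G (t + 1) = (run A G t).bind (stepLaw A G) := rfl

theorem stepLaw_of_query {h : History n} {q : Query n} (hq : A h = .inl q) :
    stepLaw A G h = (oracle G q).map fun a => h ++ [(q, a)] := by
  simp [stepLaw, hq]

theorem stepLaw_of_halt {h : History n} {x : ℝ} (hx : A h = .inr x) :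
    stepLaw A G h = PMF.pure h := by
  simp [stepLaw, hx]

/-- Histories at which the algorithm has halted with an output in `S`. -/
def haltsIn (A : DetAlg n) (S : Set ℝ) : Set (History n) := {h | ∃ x ∈ S, A h = Sum.inr x}

/-- Histories at which the algorithm makes a further query. -/
def proceeds (A : DetAlg n) : Set (History n) := {h | ∃ q, A h = Sum.inl q}

theorem length_of_mem_support_run {t : ℕ} {h : History n} (hh : h ∈ (run A G t).support) :
    h.length ≤ t ∧ (h ∈ proceeds A → h.length = t) := by
  induction t generalizing h with
  | zero =>
    have : h = [] := by simpa [run] using hh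
    simp [this]
  | succ t ih =>
    rw [run_succ, PMF.mem_support_bind_iff] at hh
    obtain ⟨h', hh', hs⟩ := hh
    rcases hA : A h' with q | x
    · rw [stepLaw_of_query hA, PMF.mem_support_map_iff] at hs
      obtain ⟨a, -, rfl⟩ := hs
      have := (ih hh').2 ⟨q, hA⟩
      simp [this]
    · rw [stepLaw_of_halt hA, PMF.mem_support_pure_iff] at hs
      subst hs
      refine ⟨(ih hh').1.trans (Nat.le_succ t), ?_⟩
      rintro ⟨q, hq⟩
      simp [hA] at hq

theorem haltsIn_run_mono (S : Set ℝ) :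
    Monotone fun t => (run A G t).toOuterMeasure (haltsIn A S) := by
  refine monotone_nat_of_le_succ fun t => ?_
  rw [run_succ, PMF.toOuterMeasure_bind_apply, PMF.toOuterMeasure_apply]
  refine ENNReal.tsum_le_tsum fun h => ?_
  by_cases hh : h ∈ haltsIn A S
  · obtain ⟨x, hx, hA⟩ := id hh
    rw [Set.indicator_of_mem hh, stepLaw_of_halt hA, PMF.toOuterMeasure_pure_apply, if_pos hh,
      mul_one]
  · simp [Set.indicator_of_notMem hh]

theorem toOuterMeasure_add_le_one {α : Type*} (p : PMF α) {s t : Set α} (hst : Disjoint s t) :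
    p.toOuterMeasure s + p.toOuterMeasure t ≤ 1 := by
  rw [PMF.toOuterMeasure_apply, PMF.toOuterMeasure_apply, ← ENNReal.tsum_add, ← p.tsum_coe]
  refine ENNReal.tsum_le_tsum fun a => ?_
  refine (congrFun (Set.indicator_union_of_disjoint hst p) a).symm.le.trans ?_
  exact Set.indicator_le_self _ _ _

theorem one_le_toOuterMeasure_add {α : Type*} (p : PMF α) {s t : Set α} (hst : s ∪ t = Set.univ) :
    1 ≤ p.toOuterMeasure s + p.toOuterMeasure t := by
  have h1 : p.toOuterMeasure (Set.univ) = 1 := by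
    rw [PMF.toOuterMeasure_apply_eq_one_iff]; exact Set.subset_univ _
  rw [← h1, ← hst]
  exact MeasureTheory.measure_union_le s t

theorem toOuterMeasure_le_one {α : Type*} (p : PMF α) (s : Set α) : p.toOuterMeasure s ≤ 1 := by
  simpa using toOuterMeasure_add_le_one p (Set.disjoint_empty s)

theorem disjoint_haltsIn {S S' : Set ℝ} (h : Disjoint S S') :
    Disjoint (haltsIn A S) (haltsIn A S') := by
  rw [Set.disjoint_left]
  rintro k ⟨x, hx, hA⟩ ⟨y, hy, hA'⟩
  rw [hA] at hA'
  obtain rfl := Sum.inr.inj hA'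
  exact Set.disjoint_left.mp h hx hy

/-- Whatever has halted outside `S` by round `q` never outputs in `S`; the rest has halted in `S` or
is still querying. -/
theorem probOutput_le_run (S : Set ℝ) (q : ℕ) :
    A.probOutput G S ≤
      (run A G q).toOuterMeasure (haltsIn A S) + (run A G q).toOuterMeasure (proceeds A) := by
  refine iSup_le fun t => ?_
  change (run A G t).toOuterMeasure (haltsIn A S) ≤ _
  rcases le_total t q with htq | hqt
  · exact (haltsIn_run_mono S htq).trans le_self_add
  · have h1 : (run A G t).toOuterMeasure (haltsIn A S) +
        (run A G q).toOuterMeasure (haltsIn A Sᶜ) ≤ 1 :=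
      (add_le_add_right (haltsIn_run_mono Sᶜ hqt) _).trans
        (toOuterMeasure_add_le_one _ (disjoint_haltsIn disjoint_compl_right))
    have h2 : 1 ≤ (run A G q).toOuterMeasure (haltsIn A S ∪ proceeds A) +
        (run A G q).toOuterMeasure (haltsIn A Sᶜ) := by
      refine one_le_toOuterMeasure_add _ (Set.eq_univ_of_forall fun h => ?_)
      rcases hA : A h with p | x
      · exact .inl (.inr ⟨p, hA⟩)
      · by_cases hx : x ∈ S
        · exact .inl (.inl ⟨x, hx, hA⟩)
        · exact .inr ⟨x, hx, hA⟩
    have h3 := h1.trans h2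
    have hfin : (run A G q).toOuterMeasure (haltsIn A Sᶜ) ≠ ∞ :=
      ne_top_of_le_ne_top ENNReal.one_ne_top (toOuterMeasure_le_one _ _)
    exact ((ENNReal.add_le_add_iff_right hfin).mp h3).trans
      (MeasureTheory.measure_union_le _ _)

theorem run_add_probOutput_le_one {S S' : Set ℝ} (hS : Disjoint S S') (q : ℕ) :
    (run A G q).toOuterMeasure (haltsIn A S) + A.probOutput G S' ≤ 1 := by
  rw [DetAlg.probOutput, ENNReal.add_iSup]
  refine iSup_le fun t => ?_
  change _ + (run A G t).toOuterMeasure (haltsIn A S') ≤ 1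
  exact (add_le_add (haltsIn_run_mono S (le_max_left q t))
    (haltsIn_run_mono S' (le_max_right q t))).trans
    (toOuterMeasure_add_le_one _ (disjoint_haltsIn hS))

/-- Histories containing a query that the two oracles answer with different laws. -/
def distinguishing (G G' : SimpleGraph (Fin n)) : Set (History n) :=
  {h | ∃ p ∈ h, oracle G p.1 ≠ oracle G' p.1}

/-- Along `h` the two runs multiply the same answer probabilities. -/
theorem run_apply_eq_of_notMem_distinguishing {t : ℕ} {h : History n}
    (hh : h ∉ distinguishing G G') : run A G t h = run A G' t h := by
  induction t generalizing h with
  | zero => rfl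
  | succ t ih =>
    rw [run_succ, run_succ, PMF.bind_apply, PMF.bind_apply]
    refine tsum_congr fun h' => ?_
    rcases hA : A h' with q | x
    · rw [stepLaw_of_query hA, stepLaw_of_query hA]
      by_cases hex : ∃ a, h = h' ++ [(q, a)]
      · obtain ⟨a, rfl⟩ := hex
        have h1 : h' ∉ distinguishing G G' := fun ⟨p, hp, hne⟩ =>
          hh ⟨p, List.mem_append_left _ hp, hne⟩
        have h2 : oracle G q = oracle G' q := by
          by_contra hne
          exact hh ⟨(q, a), by simp, hne⟩
        rw [ih h1, h2]
      · have hz : ∀ K : SimpleGraph (Fin n),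
            ((oracle K q).map fun a => h' ++ [(q, a)]) h = 0 := by
          intro K
          rw [PMF.apply_eq_zero_iff, PMF.mem_support_map_iff]
          rintro ⟨a, -, ha⟩
          exact hex ⟨a, ha.symm⟩
        rw [hz, hz, mul_zero, mul_zero]
    · rw [stepLaw_of_halt hA, stepLaw_of_halt hA]
      by_cases he : h = h'
      · subst he
        rw [ih hh]
      · rw [PMF.pure_apply_of_ne _ _ he, mul_zero, mul_zero]

theorem run_toOuterMeasure_le_add_distinguishing (t : ℕ) (E : Set (History n)) :
    (run A G t).toOuterMeasure E ≤
      (run A G' t).toOuterMeasure E + (run A G t).toOuterMeasure (distinguishing G G') := by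
  classical
  rw [PMF.toOuterMeasure_apply, PMF.toOuterMeasure_apply, PMF.toOuterMeasure_apply,
    ← ENNReal.tsum_add]
  refine ENNReal.tsum_le_tsum fun h => ?_
  by_cases hd : h ∈ distinguishing G G'
  · rw [Set.indicator_of_mem hd]
    exact (Set.indicator_le_self _ _ _).trans le_add_self
  · simp only [Set.indicator_apply, run_apply_eq_of_notMem_distinguishing hd]
    exact le_self_add

/-- If the outputs in `S` and `S'` are correct for `G` and `G'`, then a successful algorithm either
proceeds beyond `q` rounds or distinguishes the two graphs. -/
theorem probOutput_add_probOutput_le {S S' : Set ℝ} (hS : Disjoint S S') (q : ℕ) :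
    A.probOutput G S + A.probOutput G' S' ≤
      1 + ((run A G q).toOuterMeasure (distinguishing G G') +
        (run A G q).toOuterMeasure (proceeds A)) := by
  have h1 := probOutput_le_run (A := A) (G := G) S q
  have h2 := run_toOuterMeasure_le_add_distinguishing (A := A) (G := G) (G' := G') q (haltsIn A S)
  have h3 := run_add_probOutput_le_one (A := A) (G := G') hS q
  calc A.probOutput G S + A.probOutput G' S'
      ≤ ((run A G' q).toOuterMeasure (haltsIn A S) +
          (run A G q).toOuterMeasure (distinguishing G G') +
          (run A G q).toOuterMeasure (proceeds A)) + A.probOutput G' S' := by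
        gcongr
        exact h1.trans (by gcongr)
    _ = ((run A G' q).toOuterMeasure (haltsIn A S) + A.probOutput G' S') +
          ((run A G q).toOuterMeasure (distinguishing G G') +
          (run A G q).toOuterMeasure (proceeds A)) := by ring
    _ ≤ _ := by gcongr

/-- Markov's inequality: a run that proceeds after `q` rounds has made exactly `q` queries and makes
one more. -/
theorem mul_proceeds_le_expectedQueries (q : ℕ) :
    ((q : ℝ≥0∞) + 1) * (run A G q).toOuterMeasure (proceeds A) ≤ A.expectedQueries G := by
  refine le_trans ?_ (le_iSup _ (q + 1))
  have h1 : (run A G q).toOuterMeasure (proceeds A) ≤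
      (run A G (q + 1)).toOuterMeasure {h | h.length = q + 1} := by
    rw [run_succ, PMF.toOuterMeasure_bind_apply, PMF.toOuterMeasure_apply]
    refine ENNReal.tsum_le_tsum fun h => ?_
    by_cases hs : h ∈ (run A G q).support
    · by_cases hh : h ∈ proceeds A
      · obtain ⟨p, hp⟩ := id hh
        rw [Set.indicator_of_mem hh, stepLaw_of_query hp, PMF.toOuterMeasure_map_apply]
        have : (fun a => h ++ [(p, a)]) ⁻¹' {h : History n | h.length = q + 1} = Set.univ := by
          ext a
          simp [(length_of_mem_support_run hs).2 hh]
        rw [this, (PMF.toOuterMeasure_apply_eq_one_iff _ _).mpr (Set.subset_univ _), mul_one]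
      · simp [Set.indicator_of_notMem hh]
    · have h0 := (PMF.apply_eq_zero_iff _ _).mpr hs
      simp [h0]
  calc ((q : ℝ≥0∞) + 1) * (run A G q).toOuterMeasure (proceeds A)
      ≤ ((q : ℝ≥0∞) + 1) * (run A G (q + 1)).toOuterMeasure {h | h.length = q + 1} := by gcongr
    _ ≤ _ := by
      rw [PMF.toOuterMeasure_apply, ← ENNReal.tsum_mul_left]
      refine ENNReal.tsum_le_tsum fun h => ?_
      by_cases hl : h.length = q + 1
      · rw [Set.indicator_of_mem (by exact hl), hl, mul_comm]
        push_cast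
        rfl
      · rw [Set.indicator_of_notMem (by exact hl), mul_zero]
        exact zero_le

end Histories

/-! ### Averaging over the random seed. -/

section Measurability

variable {n : ℕ} {Ω : Type*} [MeasurableSpace Ω]

instance instCountableQuery (n : ℕ) : Countable (Query n) := by
  let f : Query n → Fin n ⊕ Fin n ⊕ Finset (Fin n) := fun q =>
    match q with
    | .deg v => .inl v
    | .neigh v => .inr (.inl v)
    | .indep S => .inr (.inr S)
  refine Function.Injective.countable (f := f) ?_
  intro a b hab
  cases a <;> cases b <;> simp_all [f]

instance instCountableAnswer (n : ℕ) : Countable (Answer n) := by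
  let f : Answer n → ℕ ⊕ Option (Fin n) ⊕ Bool := fun q =>
    match q with
    | .deg v => .inl v
    | .neigh v => .inr (.inl v)
    | .indep S => .inr (.inr S)
  refine Function.Injective.countable (f := f) ?_
  intro a b hab
  cases a <;> cases b <;> simp_all [f]

theorem RandAlg.measurable_stepLaw (A : RandAlg n Ω) (G : SimpleGraph (Fin n)) (h k : History n) :
    Measurable fun ω => stepLaw (A.toDet ω) G h k := by
  let F : Query n ⊕ ℝ → ℝ≥0∞ := Sum.elim
    (fun q => ((oracle G q).map fun a => h ++ [(q, a)]) k) (fun _ => PMF.pure h k)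
  have hF : Measurable F :=
    Measurable.sumElim (fun _ _ => trivial) measurable_const
  have : (fun ω => stepLaw (A.toDet ω) G h k) = fun ω => F (A.toDet ω h) := by
    funext ω
    rcases hA : A.toDet ω h with q | x
    · rw [stepLaw_of_query hA]; rfl
    · rw [stepLaw_of_halt hA]; rfl
  rw [this]
  exact hF.comp (A.measurable_toDet h)

theorem RandAlg.measurable_run (A : RandAlg n Ω) (G : SimpleGraph (Fin n)) (t : ℕ)
    (h : History n) : Measurable fun ω => run (A.toDet ω) G t h := by
  induction t generalizing h with
  | zero => exact measurable_const
  | succ t ih =>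
    simp only [run_succ, PMF.bind_apply]
    exact Measurable.tsum fun k => (ih k).mul (A.measurable_stepLaw G k h)

theorem RandAlg.measurable_proceeds (A : RandAlg n Ω) (G : SimpleGraph (Fin n)) (t : ℕ) :
    Measurable fun ω => (run (A.toDet ω) G t).toOuterMeasure (proceeds (A.toDet ω)) := by
  classical
  simp only [PMF.toOuterMeasure_apply, Set.indicator_apply]
  refine Measurable.tsum fun h => Measurable.ite ?_ (A.measurable_run G t h)
    measurable_const
  have : {ω | h ∈ proceeds (A.toDet ω)} = (fun ω => A.toDet ω h) ⁻¹' (Set.range Sum.inl) := by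
    ext ω
    simp [proceeds, eq_comm]
  change MeasurableSet {ω | h ∈ proceeds (A.toDet ω)}
  rw [this]
  exact A.measurable_toDet h measurableSet_range_inl

/-- If an algorithm succeeds on all graphs of two families `G` and `G'` with disjoint sets of
correct outputs, and hardly any deterministic algorithm distinguishes `G i` from `G' i` within
`q` rounds for most `i`, then it makes many queries on some `G i`. -/
theorem RandAlg.exists_le_expectedQueries {ι : Type*} [Fintype ι] [Nonempty ι]
    (μ : MeasureTheory.Measure Ω) [MeasureTheory.IsProbabilityMeasure μ] (A : RandAlg n Ω)
    (G G' : ι → SimpleGraph (Fin n)) (S S' : ι → Set ℝ) (hdisj : ∀ i, Disjoint (S i) (S' i))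
    (hS : ∀ i, 2 / 3 ≤ A.probOutput μ (G i) (S i))
    (hS' : ∀ i, 2 / 3 ≤ A.probOutput μ (G' i) (S' i)) (q : ℕ)
    (hq : ∀ B : DetAlg n,
      ∑ i, (run B (G i) q).toOuterMeasure (distinguishing (G i) (G' i)) ≤
        (Fintype.card ι : ℝ≥0∞) / 12) :
    ∃ i, ((q : ℝ≥0∞) + 1) / 4 ≤ A.expectedQueries μ (G i) := by
  by_contra! hlt
  set N : ℝ≥0∞ := (Fintype.card ι : ℝ≥0∞) with hN
  have hq0 : ((q : ℝ≥0∞) + 1) ≠ 0 := by simp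
  have hqtop : ((q : ℝ≥0∞) + 1) ≠ ∞ := by simp
  let P : ι → Ω → ℝ≥0∞ := fun i ω =>
    (run (A.toDet ω) (G i) q).toOuterMeasure (proceeds (A.toDet ω))
  have hP : ∀ i, ∫⁻ ω, P i ω ∂μ < 1 / 4 := by
    intro i
    have h1 : ((q : ℝ≥0∞) + 1) * ∫⁻ ω, P i ω ∂μ ≤ A.expectedQueries μ (G i) := by
      rw [← MeasureTheory.lintegral_const_mul _ (A.measurable_proceeds (G i) q)]
      exact MeasureTheory.lintegral_mono fun ω => mul_proceeds_le_expectedQueries q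
    have h2 := h1.trans_lt (hlt i)
    rw [div_eq_mul_inv] at h2
    rw [one_div]
    exact (ENNReal.mul_lt_mul_iff_right hq0 hqtop).mp h2
  have hsum : ∑ i, ∫⁻ ω, P i ω ∂μ < N / 4 := by
    calc ∑ i, ∫⁻ ω, P i ω ∂μ < ∑ _i : ι, (1 / 4 : ℝ≥0∞) :=
          ENNReal.sum_lt_sum_of_nonempty Finset.univ_nonempty fun i _ => hP i
      _ = N / 4 := by
          rw [Finset.sum_const, Finset.card_univ, nsmul_eq_mul, mul_one_div]
  have hpt : ∀ ω, ∑ i, ((A.toDet ω).probOutput (G i) (S i) +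
      (A.toDet ω).probOutput (G' i) (S' i)) ≤ (N + N / 12) + ∑ i, P i ω := by
    intro ω
    calc _ ≤ ∑ i, (1 + ((run (A.toDet ω) (G i) q).toOuterMeasure (distinguishing (G i) (G' i)) +
          P i ω)) := Finset.sum_le_sum fun i _ => probOutput_add_probOutput_le (hdisj i) q
      _ = N + (∑ i, (run (A.toDet ω) (G i) q).toOuterMeasure (distinguishing (G i) (G' i)) +
          ∑ i, P i ω) := by
          rw [Finset.sum_add_distrib, Finset.sum_add_distrib]
          simp [hN]
      _ ≤ N + (N / 12 + ∑ i, P i ω) := by gcongr; exact hq _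
      _ = _ := by rw [add_assoc]
  have hint : N * (4 / 3) ≤ (N + N / 12) + ∑ i, ∫⁻ ω, P i ω ∂μ := by
    calc N * (4 / 3) = ∑ _i : ι, (2 / 3 + 2 / 3 : ℝ≥0∞) := by
          rw [Finset.sum_const, Finset.card_univ, nsmul_eq_mul, hN, ← ENNReal.add_div]
          norm_num
      _ ≤ ∑ i, ∫⁻ ω, ((A.toDet ω).probOutput (G i) (S i) +
            (A.toDet ω).probOutput (G' i) (S' i)) ∂μ :=
          Finset.sum_le_sum fun i _ =>
            (add_le_add (hS i) (hS' i)).trans (MeasureTheory.le_lintegral_add _ _)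
      _ ≤ ∫⁻ ω, ∑ i, ((A.toDet ω).probOutput (G i) (S i) +
            (A.toDet ω).probOutput (G' i) (S' i)) ∂μ := by
          classical
          -- Only superadditivity of the lower integral is used, so measurability of `probOutput` is
          -- never needed.
          refine Finset.induction_on (Finset.univ : Finset ι) (by simp) ?_
          intro i s hi ih
          simp only [Finset.sum_insert hi]
          exact (add_le_add_right ih _).trans (MeasureTheory.le_lintegral_add _ _)
      _ ≤ ∫⁻ ω, ((N + N / 12) + ∑ i, P i ω) ∂μ := MeasureTheory.lintegral_mono hpt
      _ = _ := by
          rw [MeasureTheory.lintegral_add_left measurable_const,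
            MeasureTheory.lintegral_finsetSum _ fun i _ => A.measurable_proceeds (G i) q]
          simp [P]
  have hfin : N + N / 12 ≠ ∞ := by
    simp [hN, ENNReal.div_eq_top]
  have := hint.trans_lt (ENNReal.add_lt_add_left hfin hsum)
  -- The constants balance exactly, 4/3 = 1 + 1/12 + 1/4, and the strict inequality gives the
  -- contradiction.
  refine this.ne ?_
  have hr : N = ENNReal.ofReal (Fintype.card ι : ℝ) := by simp [hN]
  have h12 : (12 : ℝ≥0∞) = ENNReal.ofReal 12 := by norm_num
  have h4 : (4 : ℝ≥0∞) = ENNReal.ofReal 4 := by norm_num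
  have h3 : (3 : ℝ≥0∞) = ENNReal.ofReal 3 := by norm_num
  rw [hr, h12, h4, h3, ← ENNReal.ofReal_div_of_pos (by norm_num),
    ← ENNReal.ofReal_div_of_pos (by norm_num), ← ENNReal.ofReal_div_of_pos (by norm_num),
    ← ENNReal.ofReal_mul (by positivity), ← ENNReal.ofReal_add (by positivity) (by positivity),
    ← ENNReal.ofReal_add (by positivity) (by positivity)]
  congr 1
  ring

end Measurability

/-! ### When two graphs answer a query alike. -/

section Oracle

variable {n : ℕ} {G G' : SimpleGraph (Fin n)}

theorem oracle_deg_congr {v : Fin n} (h : ∀ u, G.Adj v u ↔ G'.Adj v u) :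
    oracle G (.deg v) = oracle G' (.deg v) := by
  classical
  have : G.neighborFinset v = G'.neighborFinset v := by ext u; simp [h]
  simp only [oracle, SimpleGraph.degree]
  congr 2
  convert congrArg Finset.card this

theorem oracle_neigh_congr {v : Fin n} (h : ∀ u, G.Adj v u ↔ G'.Adj v u) :
    oracle G (.neigh v) = oracle G' (.neigh v) := by
  classical
  have : G.neighborSet v = G'.neighborSet v := by ext u; simp [h]
  simp only [oracle, randomNeighbor, SimpleGraph.neighborFinset, this]
  congr!

theorem oracle_indep_congr {S : Finset (Fin n)}
    (h : G.IsIndepSet (S : Set (Fin n)) ↔ G'.IsIndepSet (S : Set (Fin n))) :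
    oracle G (.indep S) = oracle G' (.indep S) := by
  exact congrArg (fun b => PMF.pure (Answer.indep b)) (decide_eq_decide.mpr h)

end Oracle

/-- Exchanging the sums turns the left side into the expected number of `i` with `a ∈ E i`. -/
theorem sum_toOuterMeasure_le {α ι : Type*} [Fintype ι] (p : PMF α) (E : ι → Set α) {c : ℝ≥0∞}
    (h : ∀ a ∈ p.support, ({i | a ∈ E i}.ncard : ℝ≥0∞) ≤ c) :
    ∑ i, p.toOuterMeasure (E i) ≤ c := by
  classical
  simp only [PMF.toOuterMeasure_apply]
  rw [← Summable.tsum_finsetSum fun _ _ => ENNReal.summable]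
  calc ∑' a, ∑ i, (E i).indicator (⇑p) a ≤ ∑' a, p a * c := by
        refine ENNReal.tsum_le_tsum fun a => ?_
        by_cases ha : a ∈ p.support
        · refine le_trans (le_of_eq ?_) (mul_le_mul_right (h a ha) (p a))
          simp only [Set.indicator_apply]
          rw [← Finset.sum_filter, Finset.sum_const, nsmul_eq_mul, mul_comm,
            Set.ncard_eq_toFinset_card']
          congr 3
          ext i
          simp
        · simp [Set.indicator_apply, (PMF.apply_eq_zero_iff _ _).mpr ha]
    _ = c := by rw [ENNReal.tsum_mul_right, p.tsum_coe, one_mul]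

/-! ### Counting edges and padding a graph to `m` edges. -/

section EdgeCounts

variable {n : ℕ}

theorem ncard_edgeSet_map_top {z : ℕ} (f : Fin z ↪ Fin n) :
    ((⊤ : SimpleGraph (Fin z)).map f).edgeSet.ncard = z.choose 2 := by
  classical
  rw [SimpleGraph.edgeSet_map, Set.ncard_image_of_injective _ f.sym2Map.injective,
    ← SimpleGraph.coe_edgeFinset, Set.ncard_coe_finset,
    SimpleGraph.card_edgeFinset_top_eq_card_choose_two, Fintype.card_fin]

theorem exists_ge_ncard_edgeSet_eq (H : SimpleGraph (Fin n)) {m : ℕ}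
    (hH : H.edgeSet.ncard ≤ m) (hm : m ≤ n.choose 2) :
    ∃ G : SimpleGraph (Fin n), H ≤ G ∧ G.edgeSet.ncard = m := by
  classical
  have h1 : H.edgeFinset ⊆ (⊤ : SimpleGraph (Fin n)).edgeFinset :=
    SimpleGraph.edgeFinset_mono le_top
  have h2 : H.edgeFinset.card ≤ m := by
    rwa [← SimpleGraph.coe_edgeFinset, Set.ncard_coe_finset] at hH
  have h3 : m ≤ (⊤ : SimpleGraph (Fin n)).edgeFinset.card := by
    rwa [SimpleGraph.card_edgeFinset_top_eq_card_choose_two, Fintype.card_fin]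
  obtain ⟨E, hHE, hE, hcard⟩ := Finset.exists_subsuperset_card_eq h1 h2 h3
  have hset : (SimpleGraph.fromEdgeSet (E : Set (Sym2 (Fin n)))).edgeSet = E := by
    rw [SimpleGraph.edgeSet_fromEdgeSet, sdiff_eq_left, Set.disjoint_left]
    intro e he
    have := hE he
    rw [SimpleGraph.mem_edgeFinset] at this
    exact SimpleGraph.not_isDiag_of_mem_edgeSet _ this
  refine ⟨SimpleGraph.fromEdgeSet (E : Set (Sym2 (Fin n))), ?_, ?_⟩
  · rw [← SimpleGraph.edgeSet_subset_edgeSet, hset, ← SimpleGraph.coe_edgeFinset]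
    exact_mod_cast hHE
  · rw [hset, Set.ncard_coe_finset, hcard]

end EdgeCounts

/-! ### The dense case: emptying a part of a clique. -/

section Removal

variable {n p z : ℕ}

/-- The `a`-th of `p` disjoint vertex sets of size `z`. -/
def part (e : Fin p × Fin z ↪ Fin n) (a : Fin p) : Fin z ↪ Fin n :=
  ⟨fun i => e (a, i), fun _ _ h => (Prod.mk.inj (e.injective h)).2⟩

/-- `G` without the edges inside the `a`-th part. -/
def removePart (G : SimpleGraph (Fin n)) (e : Fin p × Fin z ↪ Fin n) (a : Fin p) :
    SimpleGraph (Fin n) :=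
  G \ (⊤ : SimpleGraph (Fin z)).map (part e a)

theorem removePart_adj_of_notMem {G : SimpleGraph (Fin n)} {e : Fin p × Fin z ↪ Fin n}
    {a : Fin p} {v : Fin n} (hv : v ∉ Set.range (part e a)) (u : Fin n) :
    G.Adj v u ↔ (removePart G e a).Adj v u := by
  rw [removePart, SimpleGraph.sdiff_adj, SimpleGraph.map_adj]
  refine ⟨fun h => ⟨h, ?_⟩, fun h => h.1⟩
  rintro ⟨i, -, -, rfl, -⟩
  exact hv ⟨i, rfl⟩

/-- A degree or neighbor query is affected only by the part containing its vertex. An independent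
set stays independent; in a dependent set any chosen edge survives unless the removed part contains
its endpoint, so again only one part matters. -/
theorem ncard_oracle_removePart_le_one (G : SimpleGraph (Fin n)) (e : Fin p × Fin z ↪ Fin n)
    (r : Query n) : {a | oracle G r ≠ oracle (removePart G e a) r}.ncard ≤ 1 := by
  have key : (∀ a, oracle G r = oracle (removePart G e a) r) ∨ ∃ v, ∀ a, oracle G r ≠ oracle (removePart G e a) r →
      v ∈ Set.range (part e a) := by
    cases r with
    | deg v =>
      refine .inr ⟨v, fun a ha => ?_⟩
      by_contra hv
      exact ha (oracle_deg_congr (removePart_adj_of_notMem hv))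
    | neigh v =>
      refine .inr ⟨v, fun a ha => ?_⟩
      by_contra hv
      exact ha (oracle_neigh_congr (removePart_adj_of_notMem hv))
    | indep S =>
      by_cases hS : G.IsIndepSet (S : Set (Fin n))
      · refine .inl fun a => oracle_indep_congr ⟨fun _ => ?_, fun _ => hS⟩
        exact fun u hu w hw hne h => hS hu hw hne h.1
      · have : ∃ u ∈ S, ∃ w ∈ S, G.Adj u w := by
          by_contra! hcon
          exact hS fun u hu w hw _ => hcon u hu w hw
        obtain ⟨u, hu, w, hw, huw⟩ := this
        refine .inr ⟨u, fun a ha => ?_⟩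
        by_contra hv
        refine ha (oracle_indep_congr ⟨fun h => (hS h).elim, fun h => ?_⟩)
        exact (h hu hw huw.ne ((removePart_adj_of_notMem hv w).mp huw)).elim
  obtain hall | ⟨v, hv⟩ := key
  · have : {a | oracle G r ≠ oracle (removePart G e a) r} = ∅ :=
      Set.eq_empty_of_forall_notMem fun a ha => ha (hall a)
    simp only [this, Set.ncard_empty, zero_le]
  rw [Set.ncard_le_one]
  intro a ha b hb
  obtain ⟨i, hi⟩ := hv a ha
  obtain ⟨j, hj⟩ := hv b hb
  exact (Prod.mk.inj (e.injective (hi.trans hj.symm))).1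

theorem sum_distinguishing_removePart_le (B : DetAlg n) (G : SimpleGraph (Fin n))
    (e : Fin p × Fin z ↪ Fin n) (q : ℕ) :
    ∑ a, (run B G q).toOuterMeasure (distinguishing G (removePart G e a)) ≤ q := by
  refine sum_toOuterMeasure_le _ _ fun h hh => ?_
  have key : ∀ h : History n,
      {a | h ∈ distinguishing G (removePart G e a)}.ncard ≤ h.length := by
    intro h
    induction h with
    | nil => simp [distinguishing]
    | cons x h ih =>
      have : {a | x :: h ∈ distinguishing G (removePart G e a)} =
          {a | oracle G x.1 ≠ oracle (removePart G e a) x.1} ∪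
            {a | h ∈ distinguishing G (removePart G e a)} := by
        ext a
        simp only [distinguishing, Set.mem_ofPred_eq, List.mem_cons, exists_eq_or_imp,
          Set.mem_union]
      rw [this, List.length_cons, add_comm]
      exact (Set.ncard_union_le _ _).trans
        (add_le_add (ncard_oracle_removePart_le_one G e x.1) ih)
  exact_mod_cast (key h).trans (length_of_mem_support_run hh).1

theorem ncard_edgeSet_removePart_add {G : SimpleGraph (Fin n)} {e : Fin p × Fin z ↪ Fin n}
    {a : Fin p} (hG : (⊤ : SimpleGraph (Fin z)).map (part e a) ≤ G) :
    (removePart G e a).edgeSet.ncard + z.choose 2 = G.edgeSet.ncard := by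
  rw [removePart, SimpleGraph.edgeSet_sdiff, ← ncard_edgeSet_map_top (part e a)]
  exact Set.ncard_sdiff_add_ncard_of_subset (SimpleGraph.edgeSet_subset_edgeSet.mpr hG)

theorem exists_le_expectedQueries_of_removal {Ω : Type*} [MeasurableSpace Ω]
    (μ : MeasureTheory.Measure Ω) [MeasureTheory.IsProbabilityMeasure μ] (A : RandAlg n Ω)
    {ε : ℝ} (hA : A.EstimatesEdges μ ε) {m s q : ℕ} (hm : m ≤ n.choose 2) (hsn : s ≤ n)
    (hs : s.choose 2 ≤ m) (hp : 0 < p) (hpz : p * z ≤ s) (hq : 12 * q ≤ p)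
    (hgap : ∀ m' : ℕ, m' + z.choose 2 = m → (1 + ε) * m' < (1 - ε) * m) :
    ∃ G : SimpleGraph (Fin n), G.edgeSet.ncard = m ∧
      ((q : ℝ≥0∞) + 1) / 4 ≤ A.expectedQueries μ G := by
  let ι : Fin s ↪ Fin n := Fin.castLEEmb hsn
  obtain ⟨f⟩ : Nonempty (Fin p × Fin z ↪ Fin s) :=
    Function.Embedding.nonempty_of_card_le (by simpa using hpz)
  obtain ⟨G, hG, hGm⟩ := exists_ge_ncard_edgeSet_eq ((⊤ : SimpleGraph (Fin s)).map ι)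
    ((ncard_edgeSet_map_top ι).trans_le hs) hm
  let e := f.trans ι
  have hpart : ∀ a, (⊤ : SimpleGraph (Fin z)).map (part e a) ≤ G := by
    intro a
    refine le_trans ?_ hG
    intro u v
    rw [SimpleGraph.map_adj, SimpleGraph.map_adj]
    rintro ⟨i, j, hij, rfl, rfl⟩
    refine ⟨f (a, i), f (a, j), ?_, rfl, rfl⟩
    intro h
    exact hij (Prod.mk.inj (f.injective h)).2
  have : Nonempty (Fin p) := ⟨⟨0, hp⟩⟩
  have hdisj : ∀ a : Fin p, Disjoint
      (Set.Icc ((1 - ε) * (G.edgeSet.ncard : ℝ)) ((1 + ε) * (G.edgeSet.ncard : ℝ)))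
      (Set.Icc ((1 - ε) * ((removePart G e a).edgeSet.ncard : ℝ))
        ((1 + ε) * ((removePart G e a).edgeSet.ncard : ℝ))) := by
    intro a
    rw [Set.disjoint_left]
    intro x hx hx'
    have := hgap _ ((ncard_edgeSet_removePart_add (hpart a)).trans hGm)
    rw [hGm] at hx
    linarith [hx.1, hx'.2]
  obtain ⟨_, h⟩ := A.exists_le_expectedQueries μ (fun _ : Fin p => G) (fun a => removePart G e a)
    _ _ hdisj (fun _ => hA _) (fun _ => hA _) q fun B => by
      refine (sum_distinguishing_removePart_le B G e q).trans ?_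
      rw [ENNReal.le_div_iff_mul_le (by simp) (by simp), Fintype.card_fin, mul_comm]
      exact_mod_cast hq
  exact ⟨G, hGm, h⟩

end Removal

/-! ### Concentration on boxes and the union bound over histories. -/

section Boxes

variable {s b : ℕ}

/-- The functions that agree with `x₀` on `J`. -/
def box (J : Finset (Fin s)) (x₀ : Fin s → Fin b) : Finset (Fin s → Fin b) :=
  Fintype.piFinset fun j => if j ∈ J then {x₀ j} else Finset.univ

theorem mem_box {J : Finset (Fin s)} {x₀ x : Fin s → Fin b} :
    x ∈ box J x₀ ↔ ∀ j ∈ J, x j = x₀ j := by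
  rw [box, Fintype.mem_piFinset]
  refine forall_congr' fun j => ?_
  split_ifs with h <;> simp [h]

theorem card_box (J : Finset (Fin s)) (x₀ : Fin s → Fin b) :
    (box J x₀).card = b ^ (Jᶜ).card := by
  rw [box, Fintype.card_piFinset, ← Finset.prod_subset (Finset.subset_univ Jᶜ)]
  · rw [← Finset.prod_const]
    refine Finset.prod_congr rfl fun j hj => ?_
    rw [if_neg (Finset.mem_compl.mp hj), Finset.card_univ, Fintype.card_fin]
  · intro j _ hj
    rw [if_pos (by simpa using hj), Finset.card_singleton]

/-- The coordinates at which `x` hits `W`. -/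
def hits (W : Finset (Fin s × Fin b)) (x : Fin s → Fin b) : Finset (Fin s) :=
  Finset.univ.filter fun j => (j, x j) ∈ W

theorem four_mul_exp_neg_five_le : 4 * Real.exp (-5) ≤ 1 / 36 := by
  have h1 : (2.718 : ℝ) ^ 5 ≤ Real.exp 1 ^ 5 :=
    pow_le_pow_left₀ (by norm_num) (by linarith [Real.exp_one_gt_d9]) 5
  rw [← Real.exp_nat_mul] at h1
  norm_num at h1
  rw [Real.exp_neg, ← div_eq_mul_inv, div_le_div_iff₀ (Real.exp_pos _) (by norm_num)]
  linarith

/-- A uniformly random point of a box is unlikely to hit a large set only a few times. -/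
theorem card_few_hits_le {q : ℕ} (hq : 0 < q) (hb : 0 < b) {J : Finset (Fin s)}
    (hJ : J.card ≤ 2 * q) (x₀ : Fin s → Fin b) {W : Finset (Fin s × Fin b)}
    (hW : 12 * q * b ≤ W.card) :
    36 * 2 ^ q * ((box J x₀).filter fun x => (hits W x).card ≤ q).card ≤ (box J x₀).card := by
  have hb' : (0 : ℝ) < b := by exact_mod_cast hb
  let w : Fin s → Finset (Fin b) := fun j => Finset.univ.filter fun y => (j, y) ∈ W
  -- An exponential moment: a point with at most `q` hits has weight at least `2 ^ (-q)`, and the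
  -- weight factors over the independent coordinates.
  let f : Fin s → Fin b → ℝ := fun j y => if j ∉ J ∧ (j, y) ∈ W then 1 / 2 else 1
  have hf0 : ∀ j y, 0 ≤ f j y := fun j y => by
    simp only [f]; split_ifs <;> norm_num
  have hcount : (((box J x₀).filter fun x => (hits W x).card ≤ q).card : ℝ) ≤
      2 ^ q * ∑ x ∈ box J x₀, ∏ j, f j (x j) := by
    rw [Finset.card_eq_sum_ones, Nat.cast_sum, Finset.mul_sum]
    refine (Finset.sum_le_sum fun x hx => ?_).trans (Finset.sum_le_sum_of_subset_of_nonneg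
      (Finset.filter_subset _ _) fun x _ _ =>
        mul_nonneg (by positivity) (Finset.prod_nonneg fun j _ => hf0 j _))
    have hx' := (Finset.mem_filter.mp hx).2
    simp only [f]
    rw [Finset.prod_ite, Finset.prod_const, Finset.prod_const_one, mul_one]
    have hle : (Finset.univ.filter fun j => j ∉ J ∧ (j, x j) ∈ W).card ≤ q :=
      (Finset.card_le_card fun j hj => by simp_all [hits]).trans hx'
    have h2 : (1 / 2 : ℝ) ^ q ≤
        (1 / 2) ^ (Finset.univ.filter fun j => j ∉ J ∧ (j, x j) ∈ W).card :=
      pow_le_pow_of_le_one (by norm_num) (by norm_num) hle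
    have h3 : (2 : ℝ) ^ q * (1 / 2) ^ q = 1 := by rw [← mul_pow]; norm_num
    calc (((1 : ℕ) : ℝ)) = 2 ^ q * (1 / 2) ^ q := by rw [h3]; simp
      _ ≤ _ := by gcongr
  have hfactor : ∀ j, ∑ y ∈ (if j ∈ J then {x₀ j} else Finset.univ), f j y ≤
      ((if j ∈ J then {x₀ j} else Finset.univ : Finset (Fin b)).card : ℝ) *
        Real.exp (-(if j ∈ J then 0 else ((w j).card : ℝ) / (2 * b))) := by
    intro j
    by_cases hj : j ∈ J
    · simp [hj, f]
    · simp only [hj, if_false, f, not_false_eq_true, true_and, Finset.card_univ, Fintype.card_fin]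
      have h1 : ∑ y : Fin b, (if (j, y) ∈ W then (1 / 2 : ℝ) else 1) = b - (w j).card / 2 := by
        have : ∀ y : Fin b, (if (j, y) ∈ W then (1 / 2 : ℝ) else 1) =
            1 - (if (j, y) ∈ W then (1 / 2 : ℝ) else 0) := by
          intro y; split_ifs <;> norm_num
        rw [Finset.sum_congr rfl fun y _ => this y, Finset.sum_sub_distrib, ← Finset.sum_filter]
        simp [w]
        ring
      rw [h1]
      calc (b : ℝ) - (w j).card / 2 = b * (-((w j).card / (2 * b)) + 1) := by
            field_simp; ring
        _ ≤ _ := by gcongr; exact Real.add_one_le_exp _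
  -- At most `2 * q * b` points of `W` lie over `J`; the remaining `10 * q * b` contribute `1 / (2 *
  -- b)` each.
  have hsum : 5 * (q : ℝ) ≤ ∑ j, (if j ∈ J then 0 else ((w j).card : ℝ) / (2 * b)) := by
    have h1 : W.card = ∑ j, (w j).card := by
      rw [Finset.card_eq_sum_card_fiberwise (f := Prod.fst) (t := Finset.univ) (by simp)]
      refine Finset.sum_congr rfl fun j _ => ?_
      refine (Finset.card_bij (fun y _ => (j, y)) ?_ ?_ ?_).symm
      · intro y hy; simpa [w] using hy
      · intro y _ y' _ h; simpa using h
      · rintro ⟨j', y⟩ hy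
        simp only [Finset.mem_filter] at hy
        obtain ⟨hy, rfl⟩ := hy
        exact ⟨y, by simpa [w] using hy, rfl⟩
    have h2 : (W.card : ℝ) ≤ 2 * q * b + ∑ j, (if j ∈ J then 0 else ((w j).card : ℝ)) := by
      have h3 : ∀ j, ((w j).card : ℝ) ≤ (if j ∈ J then (b : ℝ) else 0) +
          (if j ∈ J then 0 else ((w j).card : ℝ)) := by
        intro j
        have : (w j).card ≤ b := (Finset.card_le_univ _).trans_eq (Fintype.card_fin b)
        split_ifs
        · rw [add_zero]; exact_mod_cast this
        · rw [zero_add]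
      rw [h1, Nat.cast_sum]
      refine (Finset.sum_le_sum fun j _ => h3 j).trans ?_
      rw [Finset.sum_add_distrib]
      gcongr
      rw [← Finset.sum_filter]
      simp only [Finset.filter_mem_eq_inter, Finset.univ_inter, Finset.sum_const, nsmul_eq_mul]
      gcongr
      exact_mod_cast hJ
    have h4 : ∑ j, (if j ∈ J then 0 else ((w j).card : ℝ) / (2 * b)) =
        (∑ j, (if j ∈ J then 0 else ((w j).card : ℝ))) / (2 * b) := by
      rw [Finset.sum_div]
      refine Finset.sum_congr rfl fun j _ => ?_
      split_ifs <;> simp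
    rw [h4, le_div_iff₀ (by positivity)]
    have h5 : (12 * q * b : ℝ) ≤ W.card := by exact_mod_cast hW
    nlinarith
  have hprod : ∑ x ∈ box J x₀, ∏ j, f j (x j) ≤ (box J x₀).card * Real.exp (-5) ^ q := by
    rw [box, ← Finset.prod_univ_sum, Fintype.card_piFinset, Nat.cast_prod]
    refine (Finset.prod_le_prod (fun j _ => Finset.sum_nonneg fun y _ => hf0 j y)
      fun j _ => hfactor j).trans ?_
    rw [Finset.prod_mul_distrib, ← Real.exp_sum, Finset.sum_neg_distrib, ← Real.exp_nat_mul]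
    exact mul_le_mul_of_nonneg_left (Real.exp_le_exp.mpr (by linarith only [hsum]))
      (Finset.prod_nonneg fun j _ => Nat.cast_nonneg _)
  -- One factor `2 ^ q` comes from the moment bound; the other pays for the later union bound over
  -- `2 ^ q` values.
  have hnum : 36 * (4 * Real.exp (-5)) ^ q ≤ 1 := by
    have h1 : (4 * Real.exp (-5)) ^ q ≤ (1 / 36) ^ 1 :=
      (pow_le_pow_left₀ (by positivity) four_mul_exp_neg_five_le q).trans
        (pow_le_pow_of_le_one (by norm_num) (by norm_num) hq)
    linarith
  have : (36 * 2 ^ q * ((box J x₀).filter fun x => (hits W x).card ≤ q).card : ℝ) ≤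
      (box J x₀).card := by
    calc _ ≤ 36 * 2 ^ q * (2 ^ q * ((box J x₀).card * Real.exp (-5) ^ q)) := by
          gcongr
          exact hcount.trans (by gcongr)
      _ = (36 * (4 * Real.exp (-5)) ^ q) * (box J x₀).card := by
          rw [mul_pow, show (4 : ℝ) = 2 * 2 by norm_num, mul_pow]; ring
      _ ≤ 1 * (box J x₀).card := by gcongr
      _ = _ := one_mul _
  exact_mod_cast this

/-- If `H` takes few values on each box, then it is unlikely that the set `V (H x)` is large but
is hit by `x` only a few times. -/
theorem card_large_of_few_hits_le {α : Type*} [DecidableEq α] {q : ℕ} (hq : 0 < q) (hb : 0 < b)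
    {J : Finset (Fin s)} (hJ : J.card ≤ 2 * q) (H : (Fin s → Fin b) → α)
    (hH : ∀ x₀, ((box J x₀).image H).card ≤ 2 ^ q) (V : α → Finset (Fin s × Fin b))
    (hV : ∀ x, (hits (V (H x)) x).card ≤ q) :
    36 * (Finset.univ.filter fun x => 12 * q * b ≤ (V (H x)).card).card ≤ b ^ s := by
  let P : (Fin s → Fin b) → Prop := fun x => 12 * q * b ≤ (V (H x)).card
  have hbox : ∀ x₀, 36 * ((box J x₀).filter P).card ≤ b ^ (Jᶜ).card := by
    intro x₀
    let T := ((box J x₀).image H).filter fun h => 12 * q * b ≤ (V h).card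
    have h1 : (box J x₀).filter P ⊆
        T.biUnion fun h => (box J x₀).filter fun x => (hits (V h) x).card ≤ q := by
      intro x hx
      rw [Finset.mem_filter] at hx
      simp only [Finset.mem_biUnion, Finset.mem_filter, T, Finset.mem_image]
      exact ⟨H x, ⟨⟨x, hx.1, rfl⟩, hx.2⟩, hx.1, hV x⟩
    have h2 : T.card ≤ 2 ^ q := (Finset.card_filter_le _ _).trans (hH x₀)
    have h3 : 36 * 2 ^ q * ((box J x₀).filter P).card ≤ 2 ^ q * (box J x₀).card := by
      calc _ ≤ 36 * 2 ^ q *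
            ∑ h ∈ T, ((box J x₀).filter fun x => (hits (V h) x).card ≤ q).card := by
            gcongr
            exact (Finset.card_le_card h1).trans Finset.card_biUnion_le
        _ = ∑ h ∈ T,
            36 * 2 ^ q * ((box J x₀).filter fun x => (hits (V h) x).card ≤ q).card := by
            rw [Finset.mul_sum]
        _ ≤ ∑ _h ∈ T, (box J x₀).card := Finset.sum_le_sum fun h hh =>
            card_few_hits_le hq hb hJ x₀ (Finset.mem_filter.mp hh).2
        _ = T.card * (box J x₀).card := by rw [Finset.sum_const, smul_eq_mul]
        _ ≤ _ := by gcongr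
    rw [← card_box J x₀]
    refine Nat.le_of_mul_le_mul_left ?_ (pow_pos (two_pos) q)
    linarith
  -- Membership `x ∈ box J x₀` is symmetric in `x` and `x₀`, so each `x` is counted as often as a
  -- box has points.
  have hdouble : ∑ x₀, ((box J x₀).filter P).card =
      (Finset.univ.filter P).card * b ^ (Jᶜ).card := by
    have h1 : ∀ x₀, (box J x₀).filter P =
        Finset.bipartiteAbove (fun x₀ x => x ∈ box J x₀) (Finset.univ.filter P) x₀ := by
      intro x₀; ext x; simp [Finset.bipartiteAbove, and_comm]
    rw [Finset.sum_congr rfl fun x₀ _ => congrArg Finset.card (h1 x₀),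
      Finset.sum_card_bipartiteAbove_eq_sum_card_bipartiteBelow]
    refine Finset.sum_const_nat fun x _ => ?_
    rw [← card_box J x]
    congr 1
    ext x₀
    simp only [Finset.bipartiteBelow, Finset.mem_filter, Finset.mem_univ, true_and, mem_box]
    exact forall₂_congr fun _ _ => eq_comm
  have hpos : 0 < b ^ (Jᶜ).card := pow_pos hb _
  refine Nat.le_of_mul_le_mul_right ?_ hpos
  calc 36 * (Finset.univ.filter P).card * b ^ (Jᶜ).card
      = ∑ x₀, 36 * ((box J x₀).filter P).card := by
        rw [mul_assoc, ← hdouble, Finset.mul_sum]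
    _ ≤ ∑ _x₀ : Fin s → Fin b, b ^ (Jᶜ).card := Finset.sum_le_sum fun x₀ _ => hbox x₀
    _ = b ^ s * b ^ (Jᶜ).card := by simp

end Boxes

theorem uniformOfFinset_eq_map {α β : Type*} [Fintype α] [Nonempty α] [DecidableEq β] {f : α → β}
    (hf : Function.Injective f) {s : Finset β} (hs : s.Nonempty)
    (h : ∀ y, y ∈ s ↔ ∃ a, f a = y) :
    PMF.uniformOfFinset s hs = (PMF.uniformOfFintype α).map f := by
  have hs' : s = Finset.univ.image f := by ext y; simp [h]
  have hcard : s.card = Fintype.card α := by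
    rw [hs', Finset.card_image_of_injective _ hf, Finset.card_univ]
  ext y
  rw [PMF.map_apply, PMF.uniformOfFinset_apply]
  split_ifs with hy
  · obtain ⟨a, rfl⟩ := (h y).mp hy
    rw [tsum_eq_single a]
    · simp [hcard]
    · intro a' ha'
      rw [if_neg fun h => ha' (hf h.symm)]
  · rw [eq_comm, ENNReal.tsum_eq_zero]
    intro a
    rw [if_neg]
    rintro rfl
    exact hy ((h _).mpr ⟨a, rfl⟩)

/-! ### The hidden clique and its oracle driven by explicit seeds. -/

section HiddenClique

variable {n k b : ℕ}

/-- The clique vertices: the vertex `x i` of every block `i`. -/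
def cliqueEmb (blk : Fin (k + 1) × Fin b ↪ Fin n) (x : Fin (k + 1) → Fin b) :
    Fin (k + 1) ↪ Fin n :=
  ⟨fun i => blk (i, x i), fun _ _ h => (Prod.mk.inj (blk.injective h)).1⟩

/-- A clique with one vertex in every block, together with a fixed graph `M`. -/
def hiddenClique (blk : Fin (k + 1) × Fin b ↪ Fin n) (M : SimpleGraph (Fin n))
    (x : Fin (k + 1) → Fin b) : SimpleGraph (Fin n) :=
  (⊤ : SimpleGraph (Fin (k + 1))).map (cliqueEmb blk x) ⊔ M

/-- `M` is a matching that avoids all blocks. -/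
structure IsSideMatching (blk : Fin (k + 1) × Fin b ↪ Fin n) (M : SimpleGraph (Fin n)) : Prop where
  unique : ∀ ⦃v u w⦄, M.Adj v u → M.Adj v w → u = w
  avoids : ∀ p v, ¬ M.Adj (blk p) v

variable {blk : Fin (k + 1) × Fin b ↪ Fin n} {M : SimpleGraph (Fin n)}
  {x : Fin (k + 1) → Fin b}

theorem hiddenClique_adj_clique (hM : IsSideMatching blk M) (i : Fin (k + 1)) (u : Fin n) :
    (hiddenClique blk M x).Adj (blk (i, x i)) u ↔ ∃ j, j ≠ i ∧ blk (j, x j) = u := by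
  rw [hiddenClique, SimpleGraph.sup_adj, SimpleGraph.map_adj]
  constructor
  · rintro (⟨i', j, hij, h1, h2⟩ | h)
    · obtain rfl : i' = i := (Prod.mk.inj (blk.injective h1)).1
      exact ⟨j, hij.symm, h2⟩
    · exact (hM.avoids _ _ h).elim
  · rintro ⟨j, hj, rfl⟩
    exact .inl ⟨i, j, hj.symm, rfl, rfl⟩

theorem not_hiddenClique_adj (hM : IsSideMatching blk M) {i : Fin (k + 1)} {y : Fin b}
    (hy : y ≠ x i) (u : Fin n) : ¬ (hiddenClique blk M x).Adj (blk (i, y)) u := by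
  rw [hiddenClique, SimpleGraph.sup_adj, SimpleGraph.map_adj]
  rintro (⟨i', j, hij, h1, h2⟩ | h)
  · obtain ⟨rfl, h3⟩ := Prod.mk.inj (blk.injective h1)
    exact hy h3.symm
  · exact hM.avoids _ _ h

theorem hiddenClique_adj_of_notMem_range {v : Fin n} (hv : v ∉ Set.range blk) (u : Fin n) :
    (hiddenClique blk M x).Adj v u ↔ M.Adj v u := by
  rw [hiddenClique, SimpleGraph.sup_adj, SimpleGraph.map_adj]
  refine ⟨?_, .inr⟩
  rintro (⟨i, j, hij, h1, h2⟩ | h)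
  · exact (hv ⟨(i, x i), h1⟩).elim
  · exact h

theorem ncard_edgeSet_hiddenClique (hM : IsSideMatching blk M) :
    (hiddenClique blk M x).edgeSet.ncard = (k + 1).choose 2 + M.edgeSet.ncard := by
  rw [hiddenClique, SimpleGraph.edgeSet_sup, Set.ncard_union_eq, ncard_edgeSet_map_top]
  rw [Set.disjoint_left]
  intro e
  induction e with
  | _ u v =>
    rw [SimpleGraph.mem_edgeSet, SimpleGraph.mem_edgeSet, SimpleGraph.map_adj]
    rintro ⟨i, j, -, rfl, -⟩ h
    exact hM.avoids _ _ h

open Classical in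
/-- The neighbor of `v` that the seed `r` selects. -/
noncomputable def seedNeighbor (blk : Fin (k + 1) × Fin b ↪ Fin n) (M : SimpleGraph (Fin n))
    (x : Fin (k + 1) → Fin b) (r : Fin k) (v : Fin n) : Option (Fin n) :=
  if h : ∃ i, blk (i, x i) = v then
    some (blk (h.choose.succAbove r, x (h.choose.succAbove r)))
  else if h : ∃ u, M.Adj v u then some h.choose else none

theorem seedNeighbor_clique (i : Fin (k + 1)) (r : Fin k) :
    seedNeighbor blk M x r (blk (i, x i)) = some (blk (i.succAbove r, x (i.succAbove r))) := by
  have h : ∃ j, blk (j, x j) = blk (i, x i) := ⟨i, rfl⟩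
  have hi : h.choose = i := (Prod.mk.inj (blk.injective h.choose_spec)).1
  rw [seedNeighbor, dif_pos h, hi]

theorem seedNeighbor_block (hM : IsSideMatching blk M) {i : Fin (k + 1)} {y : Fin b}
    (hy : y ≠ x i) (r : Fin k) : seedNeighbor blk M x r (blk (i, y)) = none := by
  rw [seedNeighbor, dif_neg, dif_neg]
  · rintro ⟨u, hu⟩
    exact hM.avoids _ _ hu
  · rintro ⟨j, hj⟩
    obtain ⟨rfl, h⟩ := Prod.mk.inj (blk.injective hj)
    exact hy h.symm

theorem seedNeighbor_of_notMem_range {v : Fin n} (hv : v ∉ Set.range blk) (r : Fin k)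
    (x' : Fin (k + 1) → Fin b) :
    seedNeighbor blk M x r v = seedNeighbor blk M x' r v := by
  have : ∀ z : Fin (k + 1) → Fin b, ¬ ∃ i, blk (i, z i) = v := fun z ⟨i, hi⟩ => hv ⟨_, hi⟩
  rw [seedNeighbor, seedNeighbor, dif_neg (this x), dif_neg (this x')]

open Classical in
/-- The oracle's answer, as a function of the hidden choice `x` and of the seed `r`. -/
noncomputable def seedAnswer (blk : Fin (k + 1) × Fin b ↪ Fin n) (M : SimpleGraph (Fin n))
    (x : Fin (k + 1) → Fin b) (r : Fin k) : Query n → Answer n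
  | .deg v => .deg ((hiddenClique blk M x).degree v)
  | .neigh v => .neigh (seedNeighbor blk M x r v)
  | .indep S => .indep (decide ((hiddenClique blk M x).IsIndepSet (S : Set (Fin n))))

theorem map_eq_pure {α β : Type*} (p : PMF α) {f : α → β} {c : β} (h : ∀ a, f a = c) :
    p.map f = PMF.pure c := by
  rw [show f = Function.const α c from funext h]
  exact PMF.map_const p c

/-- At a clique vertex the seed names one of the `k` other blocks; every other answer ignores it, as
a vertex outside the clique has at most one neighbor. Hence the seed law does not depend on `x`. -/
theorem oracle_hiddenClique [Nonempty (Fin k)] (hM : IsSideMatching blk M) (q : Query n) :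
    oracle (hiddenClique blk M x) q =
      (PMF.uniformOfFintype (Fin k)).map fun r => seedAnswer blk M x r q := by
  classical
  cases q with
  | deg v => exact (map_eq_pure _ fun _ => rfl).symm
  | indep S => exact (map_eq_pure _ fun _ => rfl).symm
  | neigh v =>
    have : ((PMF.uniformOfFintype (Fin k)).map fun r => seedAnswer blk M x r (.neigh v)) =
        ((PMF.uniformOfFintype (Fin k)).map fun r => seedNeighbor blk M x r v).map
          Answer.neigh := by
      rw [PMF.map_comp]; rfl
    rw [this, oracle]
    congr 1
    by_cases hv : v ∈ Set.range blk
    · obtain ⟨⟨i, y⟩, rfl⟩ := hv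
      by_cases hy : y = x i
      · subst hy
        have hmem : ∀ u, u ∈ (hiddenClique blk M x).neighborFinset (blk (i, x i)) ↔
            ∃ r : Fin k, blk (i.succAbove r, x (i.succAbove r)) = u := by
          intro u
          rw [SimpleGraph.mem_neighborFinset, hiddenClique_adj_clique hM]
          constructor
          · rintro ⟨j, hj, rfl⟩
            obtain ⟨r, rfl⟩ := Fin.exists_succAbove_eq hj
            exact ⟨r, rfl⟩
          · rintro ⟨r, rfl⟩
            exact ⟨_, Fin.succAbove_ne i r, rfl⟩
        obtain ⟨r₀⟩ := ‹Nonempty (Fin k)›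
        have hne : ((hiddenClique blk M x).neighborFinset (blk (i, x i))).Nonempty :=
          ⟨_, (hmem _).mpr ⟨r₀, rfl⟩⟩
        have hinj : Function.Injective fun r : Fin k =>
            blk (i.succAbove r, x (i.succAbove r)) := fun r r' h =>
          Fin.succAbove_right_injective (Prod.mk.inj (blk.injective h)).1
        rw [randomNeighbor, dif_pos hne, uniformOfFinset_eq_map hinj hne hmem, PMF.map_comp]
        congr 1
        funext r
        exact (seedNeighbor_clique i r).symm
      · rw [map_eq_pure _ fun r => seedNeighbor_block hM hy r, randomNeighbor, dif_neg]
        rintro ⟨u, hu⟩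
        rw [SimpleGraph.mem_neighborFinset] at hu
        exact not_hiddenClique_adj hM hy u hu
    · have hx : ¬ ∃ i, blk (i, x i) = v := fun ⟨i, hi⟩ => hv ⟨_, hi⟩
      by_cases hu : ∃ u, M.Adj v u
      · have hN : (hiddenClique blk M x).neighborFinset v = {hu.choose} := by
          ext w
          rw [SimpleGraph.mem_neighborFinset, hiddenClique_adj_of_notMem_range hv,
            Finset.mem_singleton]
          refine ⟨fun hw => hM.unique hw hu.choose_spec, ?_⟩
          rintro rfl
          exact hu.choose_spec
        have hc : ∀ r : Fin k, seedNeighbor blk M x r v = some hu.choose := by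
          intro r
          rw [seedNeighbor, dif_neg hx, dif_pos hu]
        rw [map_eq_pure _ hc, randomNeighbor, dif_pos (by rw [hN]; exact Finset.singleton_nonempty _)]
        have h1 : PMF.uniformOfFinset {hu.choose} (Finset.singleton_nonempty _) =
            PMF.pure hu.choose := by
          ext w
          rw [PMF.uniformOfFinset_apply, PMF.pure_apply]
          simp
        simp only [hN]
        rw [h1, PMF.pure_map]
      · have hc : ∀ r : Fin k, seedNeighbor blk M x r v = none := by
          intro r
          rw [seedNeighbor, dif_neg hx, dif_neg hu]
        rw [map_eq_pure _ hc, randomNeighbor, dif_neg]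
        rintro ⟨w, hw⟩
        rw [SimpleGraph.mem_neighborFinset, hiddenClique_adj_of_notMem_range hv] at hw
        exact hu ⟨w, hw⟩

/-- On a box that fixes all blocks a seed may select, an answer is a single bit. -/
theorem exists_seedAnswer_eq_or_eq (hM : IsSideMatching blk M) {J : Finset (Fin (k + 1))}
    (x₀ : Fin (k + 1) → Fin b) {r : Fin k} (hr : ∀ i : Fin (k + 1), i.succAbove r ∈ J)
    (q : Query n) :
    ∃ a₀ a₁, ∀ x ∈ box J x₀, seedAnswer blk M x r q = a₀ ∨ seedAnswer blk M x r q = a₁ := by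
  classical
  cases q with
  | indep S =>
    refine ⟨.indep true, .indep false, fun x _ => ?_⟩
    simp only [seedAnswer]
    rcases decide ((hiddenClique blk M x).IsIndepSet (S : Set (Fin n))) <;> simp
  | deg v =>
    by_cases hv : v ∈ Set.range blk
    · obtain ⟨⟨i, y⟩, rfl⟩ := hv
      refine ⟨.deg k, .deg 0, fun x _ => ?_⟩
      simp only [seedAnswer, Answer.deg.injEq]
      by_cases hy : y = x i
      · subst hy
        left
        have : (hiddenClique blk M x).neighborFinset (blk (i, x i)) =
            (Finset.univ : Finset (Fin k)).image
              fun r => blk (i.succAbove r, x (i.succAbove r)) := by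
          ext u
          rw [SimpleGraph.mem_neighborFinset, hiddenClique_adj_clique hM]
          simp only [Finset.mem_image, Finset.mem_univ, true_and]
          constructor
          · rintro ⟨j, hj, rfl⟩
            obtain ⟨r, rfl⟩ := Fin.exists_succAbove_eq hj
            exact ⟨r, rfl⟩
          · rintro ⟨r, rfl⟩
            exact ⟨_, Fin.succAbove_ne i r, rfl⟩
        rw [SimpleGraph.degree, this, Finset.card_image_of_injective, Finset.card_univ,
          Fintype.card_fin]
        exact fun r r' h => Fin.succAbove_right_injective (Prod.mk.inj (blk.injective h)).1
      · right
        rw [SimpleGraph.degree, Finset.card_eq_zero, Finset.eq_empty_iff_forall_notMem]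
        intro u hu
        rw [SimpleGraph.mem_neighborFinset] at hu
        exact not_hiddenClique_adj hM hy u hu
    · refine ⟨.deg (M.degree v), .deg 0, fun x _ => .inl ?_⟩
      simp only [seedAnswer, Answer.deg.injEq, SimpleGraph.degree]
      congr 1
      ext u
      rw [SimpleGraph.mem_neighborFinset, SimpleGraph.mem_neighborFinset,
        hiddenClique_adj_of_notMem_range hv]
  | neigh v =>
    by_cases hv : v ∈ Set.range blk
    · obtain ⟨⟨i, y⟩, rfl⟩ := hv
      refine ⟨.neigh (some (blk (i.succAbove r, x₀ (i.succAbove r)))), .neigh none,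
        fun x hx => ?_⟩
      simp only [seedAnswer, Answer.neigh.injEq]
      by_cases hy : y = x i
      · subst hy
        left
        rw [seedNeighbor_clique, mem_box.mp hx _ (hr i)]
      · exact .inr (seedNeighbor_block hM hy r)
    · refine ⟨.neigh (seedNeighbor blk M x₀ r v), .neigh none, fun x _ => .inl ?_⟩
      simp only [seedAnswer, Answer.neigh.injEq]
      exact seedNeighbor_of_notMem_range hv r x₀

end HiddenClique

/-! ### Runs with fixed seeds and the vertices they expose. -/

section SeededRuns

variable {n k b : ℕ} {blk : Fin (k + 1) × Fin b ↪ Fin n} {M : SimpleGraph (Fin n)}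
  {A : DetAlg n}

/-- The history after the rounds with seeds `l`, the last round first. -/
noncomputable def seedRun (A : DetAlg n) (blk : Fin (k + 1) × Fin b ↪ Fin n)
    (M : SimpleGraph (Fin n)) (x : Fin (k + 1) → Fin b) : List (Fin k) → History n
  | [] => []
  | r :: l =>
    match A (seedRun A blk M x l) with
    | .inl q => seedRun A blk M x l ++ [(q, seedAnswer blk M x r q)]
    | .inr _ => seedRun A blk M x l

/-- The law of `t` independent uniform seeds. -/
noncomputable def seedLaw (k : ℕ) [Nonempty (Fin k)] : ℕ → PMF (List (Fin k))
  | 0 => PMF.pure []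
  | t + 1 => (seedLaw k t).bind fun l => (PMF.uniformOfFintype (Fin k)).map fun r => r :: l

theorem length_of_mem_support_seedLaw [Nonempty (Fin k)] {t : ℕ} {l : List (Fin k)}
    (hl : l ∈ (seedLaw k t).support) : l.length = t := by
  induction t generalizing l with
  | zero =>
    have : l = [] := by simpa [seedLaw] using hl
    simp [this]
  | succ t ih =>
    rw [seedLaw, PMF.mem_support_bind_iff] at hl
    obtain ⟨l', hl', h⟩ := hl
    obtain ⟨r, -, rfl⟩ := PMF.mem_support_map_iff _ _ _ |>.mp h
    rw [List.length_cons, ih hl']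

theorem run_hiddenClique [Nonempty (Fin k)] (hM : IsSideMatching blk M)
    (x : Fin (k + 1) → Fin b) (t : ℕ) :
    run A (hiddenClique blk M x) t = (seedLaw k t).map (seedRun A blk M x) := by
  induction t with
  | zero => rw [seedLaw, PMF.pure_map]; rfl
  | succ t ih =>
    rw [run_succ, ih, seedLaw, PMF.bind_map, PMF.map_bind]
    congr 1
    funext l
    rw [Function.comp_apply, PMF.map_comp]
    rcases hA : A (seedRun A blk M x l) with q | y
    · rw [stepLaw_of_query hA, oracle_hiddenClique hM, PMF.map_comp]
      congr 1
      funext r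
      simp [seedRun, hA]
    · rw [stepLaw_of_halt hA]
      refine (map_eq_pure _ fun r => ?_).symm
      simp [seedRun, hA]

/-- With the seeds and the coordinates in `J` fixed, the algorithm is a binary decision tree of
depth `l.length`. -/
theorem card_image_seedRun_le [DecidableEq (History n)] (hM : IsSideMatching blk M)
    {J : Finset (Fin (k + 1))} (x₀ : Fin (k + 1) → Fin b) {l : List (Fin k)}
    (hl : ∀ r ∈ l, ∀ i : Fin (k + 1), i.succAbove r ∈ J) :
    ((box J x₀).image fun x => seedRun A blk M x l).card ≤ 2 ^ l.length := by
  induction l with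
  | nil =>
    refine (Finset.card_le_card (t := {[]}) ?_).trans (by simp)
    intro h hh
    obtain ⟨x, -, rfl⟩ := Finset.mem_image.mp hh
    simp [seedRun]
  | cons r l ih =>
    have ih' := ih fun r' hr' => hl r' (List.mem_cons_of_mem _ hr')
    choose a₀ a₁ ha using exists_seedAnswer_eq_or_eq hM x₀ (hl r List.mem_cons_self)
    let N : History n → Finset (History n) := fun h =>
      match A h with
      | .inl q => {h ++ [(q, a₀ q)], h ++ [(q, a₁ q)]}
      | .inr _ => {h}
    have hN : ∀ h, (N h).card ≤ 2 := by
      intro h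
      simp only [N]
      split
      · exact Finset.card_le_two
      · simp
    have hsub : ((box J x₀).image fun x => seedRun A blk M x (r :: l)) ⊆
        ((box J x₀).image fun x => seedRun A blk M x l).biUnion N := by
      intro h hh
      obtain ⟨x, hx, rfl⟩ := Finset.mem_image.mp hh
      rw [Finset.mem_biUnion]
      refine ⟨_, Finset.mem_image_of_mem _ hx, ?_⟩
      rcases hA : A (seedRun A blk M x l) with q | y
      · simp only [seedRun, N, hA, Finset.mem_insert, Finset.mem_singleton]
        rcases ha q x hx with h | h
        · exact .inl (by rw [h])
        · exact .inr (by rw [h])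
      · simp [seedRun, N, hA]
    calc _ ≤ _ := Finset.card_le_card hsub
      _ ≤ _ := Finset.card_biUnion_le_card_mul _ _ 2 fun h _ => hN h
      _ ≤ 2 ^ l.length * 2 := by gcongr
      _ = 2 ^ (r :: l).length := by rw [List.length_cons, pow_succ]

theorem exists_seed_of_mem_seedRun {x : Fin (k + 1) → Fin b} {l : List (Fin k)}
    {e : Query n × Answer n} (he : e ∈ seedRun A blk M x l) :
    ∃ r, e.2 = seedAnswer blk M x r e.1 := by
  induction l with
  | nil => simp [seedRun] at he
  | cons r l ih =>
    rcases hA : A (seedRun A blk M x l) with q | y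
    · simp only [seedRun, hA, List.mem_append, List.mem_singleton] at he
      rcases he with he | rfl
      · exact ih he
      · exact ⟨r, rfl⟩
    · simp only [seedRun, hA] at he
      exact ih he

theorem length_seedRun_le (x : Fin (k + 1) → Fin b) (l : List (Fin k)) :
    (seedRun A blk M x l).length ≤ l.length := by
  induction l with
  | nil => simp [seedRun]
  | cons r l ih =>
    rcases hA : A (seedRun A blk M x l) with q | y
    · simpa [seedRun, hA] using ih
    · simp only [seedRun, hA, List.length_cons]
      exact ih.trans (Nat.le_succ _)

/-- The block vertex `p` is the subject of a degree or neighbor query, or lies in a set that was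
found to be independent. -/
def Exposes (blk : Fin (k + 1) × Fin b ↪ Fin n) (p : Fin (k + 1) × Fin b) :
    Query n × Answer n → Prop
  | (.deg v, _) => blk p = v
  | (.neigh v, _) => blk p = v
  | (.indep S, a) => a = .indep true ∧ blk p ∈ S

open Classical in
/-- The block vertices exposed in a history. -/
noncomputable def exposed (blk : Fin (k + 1) × Fin b ↪ Fin n) (h : History n) :
    Finset (Fin (k + 1) × Fin b) :=
  Finset.univ.filter fun p => ∃ e ∈ h, Exposes blk p e

theorem mem_exposed {p : Fin (k + 1) × Fin b} {h : History n} :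
    p ∈ exposed blk h ↔ ∃ e ∈ h, Exposes blk p e := by
  simp [exposed]

theorem mem_hits {s b : ℕ} {W : Finset (Fin s × Fin b)} {x : Fin s → Fin b} {j : Fin s} :
    j ∈ hits W x ↔ (j, x j) ∈ W := by
  simp [hits]

/-- Two clique vertices are adjacent, so they never share an independent set. -/
theorem eq_of_exposes_clique {x : Fin (k + 1) → Fin b} {r : Fin k} {q : Query n}
    {i j : Fin (k + 1)} (hi : Exposes blk (i, x i) (q, seedAnswer blk M x r q))
    (hj : Exposes blk (j, x j) (q, seedAnswer blk M x r q)) : i = j := by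
  cases q with
  | deg v => exact (Prod.mk.inj (blk.injective (Eq.trans hi (Eq.symm hj)))).1
  | neigh v => exact (Prod.mk.inj (blk.injective (Eq.trans hi (Eq.symm hj)))).1
  | indep S =>
    by_contra hij
    have h1 : (hiddenClique blk M x).IsIndepSet (S : Set (Fin n)) := by
      simpa [seedAnswer] using hi.1
    refine h1 hi.2 hj.2 ?_ (.inl ?_)
    · intro h
      exact hij (Prod.mk.inj (blk.injective h)).1
    · rw [SimpleGraph.map_adj]
      exact ⟨i, j, hij, rfl, rfl⟩

theorem card_hits_exposed_seedRun_le (x : Fin (k + 1) → Fin b) (l : List (Fin k)) :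
    (hits (exposed blk (seedRun A blk M x l)) x).card ≤ l.length := by
  classical
  induction l with
  | nil => simp [seedRun, exposed, hits]
  | cons r l ih =>
    rcases hA : A (seedRun A blk M x l) with q | y
    · have hsub : hits (exposed blk (seedRun A blk M x (r :: l))) x ⊆
          hits (exposed blk (seedRun A blk M x l)) x ∪
            Finset.univ.filter fun j => Exposes blk (j, x j) (q, seedAnswer blk M x r q) := by
        intro j hj
        rw [mem_hits, mem_exposed] at hj
        obtain ⟨e, he, hje⟩ := hj
        simp only [seedRun, hA, List.mem_append, List.mem_singleton] at he
        rw [Finset.mem_union, mem_hits, mem_exposed]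
        rcases he with he | rfl
        · exact .inl ⟨e, he, hje⟩
        · exact .inr (by simpa using hje)
      refine (Finset.card_le_card hsub).trans ((Finset.card_union_le _ _).trans ?_)
      rw [List.length_cons]
      refine add_le_add ih (Finset.card_le_one.mpr ?_)
      intro i hi j hj
      exact eq_of_exposes_clique (Finset.mem_filter.mp hi).2 (Finset.mem_filter.mp hj).2
    · simp only [seedRun, hA, List.length_cons]
      exact ih.trans (Nat.le_succ _)

/-- Only for a few of the hidden choices are many block vertices exposed. -/
theorem card_many_exposed_le (hM : IsSideMatching blk M) {q : ℕ} (hq : 0 < q) (hb : 0 < b)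
    {l : List (Fin k)} (hl : l.length = q) :
    36 * (Finset.univ.filter fun x : Fin (k + 1) → Fin b =>
      12 * q * b ≤ (exposed blk (seedRun A blk M x l)).card).card ≤ b ^ (k + 1) := by
  classical
  -- `i.succAbove r` is `r.castSucc` or `r.succ` whatever `i` is, so each seed costs two
  -- coordinates.
  let J : Finset (Fin (k + 1)) := l.toFinset.image Fin.castSucc ∪ l.toFinset.image Fin.succ
  have hJ : J.card ≤ 2 * q := by
    refine (Finset.card_union_le _ _).trans ?_
    have h1 : l.toFinset.card ≤ q := hl ▸ l.toFinset_card_le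
    have h2 := (Finset.card_image_le (s := l.toFinset) (f := Fin.castSucc)).trans h1
    have h3 := (Finset.card_image_le (s := l.toFinset) (f := Fin.succ)).trans h1
    omega
  have hJl : ∀ r ∈ l, ∀ i : Fin (k + 1), i.succAbove r ∈ J := by
    intro r hr i
    rw [Finset.mem_union, Finset.mem_image, Finset.mem_image]
    unfold Fin.succAbove
    split_ifs
    · exact .inl ⟨r, by simpa using hr, rfl⟩
    · exact .inr ⟨r, by simpa using hr, rfl⟩
  exact card_large_of_few_hits_le hq hb hJ (fun x => seedRun A blk M x l)
    (fun x₀ => hl ▸ card_image_seedRun_le hM x₀ hJl) (exposed blk)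
    (fun x => hl ▸ card_hits_exposed_seedRun_le x l)

end SeededRuns

/-! ### The sparse case: planting a complete bipartite graph. -/

section Planting

variable {n k b A t B l : ℕ}

/-- All edges between `T` and `L`. -/
def biclique (T L : Set (Fin n)) : SimpleGraph (Fin n) :=
  SimpleGraph.fromRel fun u v => u ∈ T ∧ v ∈ L

theorem biclique_adj {T L : Set (Fin n)} {u v : Fin n} (h : (biclique T L).Adj u v) :
    (u ∈ T ∧ v ∈ L) ∨ (v ∈ T ∧ u ∈ L) := by
  rw [biclique, SimpleGraph.fromRel_adj] at h
  exact h.2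

/-- Every new edge has an end in `T`, so an independent set may contain vertices of `L` freely; a
set that is already dependent stays so. -/
theorem oracle_eq_sup_biclique (G : SimpleGraph (Fin n)) {T L : Set (Fin n)} {q : Query n}
    (hdeg : ∀ v, q = .deg v → v ∉ T ∧ v ∉ L) (hneigh : ∀ v, q = .neigh v → v ∉ T ∧ v ∉ L)
    (hindep : ∀ S : Finset (Fin n), q = .indep S → G.IsIndepSet (S : Set (Fin n)) →
      ∀ v ∈ S, v ∉ T) :
    oracle G q = oracle (G ⊔ biclique T L) q := by
  have key : ∀ v, v ∉ T ∧ v ∉ L → ∀ u, G.Adj v u ↔ (G ⊔ biclique T L).Adj v u := by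
    intro v hv u
    rw [SimpleGraph.sup_adj]
    refine ⟨.inl, ?_⟩
    rintro (h | h)
    · exact h
    · rcases biclique_adj h with h | h
      · exact (hv.1 h.1).elim
      · exact (hv.2 h.2).elim
  cases q with
  | deg v => exact oracle_deg_congr (key v (hdeg v rfl))
  | neigh v => exact oracle_neigh_congr (key v (hneigh v rfl))
  | indep S =>
    refine oracle_indep_congr ⟨fun h u hu v hv hne huv => ?_,
      fun h u hu v hv hne huv => h hu hv hne (.inl huv)⟩
    rcases huv with huv | huv
    · exact h hu hv hne huv
    · rcases biclique_adj huv with h' | h'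
      · exact hindep S rfl h u hu h'.1
      · exact hindep S rfl h v hv h'.1

/-- The vertices of the `a`-th class of an indexed family of disjoint classes. -/
def classSet {α β γ : Type*} (e : α × β ↪ γ) (a : α) : Set γ := Set.range fun i => e (a, i)

theorem ncard_classSet_inter_nonempty_le {α β γ : Type*} [Fintype α] [Fintype β] (e : α × β ↪ γ)
    (S : Finset γ) : {a | ∃ p ∈ S, p ∈ classSet e a}.ncard ≤ S.card := by
  classical
  have h1 : {a | ∃ p ∈ S, p ∈ classSet e a} ⊆
      (((Finset.univ.filter fun p : α × β => e p ∈ S).image Prod.fst : Finset α) : Set α) := by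
    rintro a ⟨_, hp, i, rfl⟩
    simp only [Finset.coe_image, Set.mem_image, Finset.mem_coe, Finset.mem_filter,
      Finset.mem_univ, true_and]
    exact ⟨(a, i), hp, rfl⟩
  refine (Set.ncard_le_ncard h1 (Finset.finite_toSet _)).trans ?_
  rw [Set.ncard_coe_finset]
  refine Finset.card_image_le.trans ?_
  exact Finset.card_le_card_of_injOn e (fun p hp => (Finset.mem_filter.mp hp).2)
    e.injective.injOn

theorem le_ncard_edgeSet_sup_biclique (G : SimpleGraph (Fin n)) {T : Fin t ↪ Fin n}
    {L : Fin l ↪ Fin n} (hTL : ∀ i j, T i ≠ L j) (hL : ∀ j u, ¬ G.Adj (L j) u) :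
    G.edgeSet.ncard + t * l ≤ (G ⊔ biclique (Set.range T) (Set.range L)).edgeSet.ncard := by
  let f : Fin t × Fin l → Sym2 (Fin n) := fun p => s(T p.1, L p.2)
  have hf : Function.Injective f := by
    rintro ⟨i, j⟩ ⟨i', j'⟩ h
    rcases Sym2.eq_iff.mp h with ⟨h1, h2⟩ | ⟨h1, h2⟩
    · exact Prod.ext (T.injective h1) (L.injective h2)
    · exact (hTL _ _ h1).elim
  have hcard : (Set.range f).ncard = t * l := by
    rw [← Set.image_univ, Set.ncard_image_of_injective _ hf, Set.ncard_univ]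
    simp
  have hdisj : Disjoint G.edgeSet (Set.range f) := by
    rw [Set.disjoint_right]
    rintro _ ⟨⟨i, j⟩, rfl⟩ h
    exact hL j _ (SimpleGraph.Adj.symm h)
  rw [← hcard, ← Set.ncard_union_eq hdisj]
  refine Set.ncard_le_ncard (Set.union_subset ?_ ?_)
  · exact SimpleGraph.edgeSet_subset_edgeSet.mpr le_sup_left
  · rintro _ ⟨⟨i, j⟩, rfl⟩
    refine .inr ?_
    rw [biclique, SimpleGraph.fromRel_adj]
    exact ⟨hTL i j, .inl ⟨⟨i, rfl⟩, ⟨j, rfl⟩⟩⟩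

/-- The vertices that are the subject of a degree or neighbor query. -/
noncomputable def visited (h : History n) : Finset (Fin n) :=
  (h.filterMap fun e =>
    match e.1 with
    | .deg v => some v
    | .neigh v => some v
    | .indep _ => none).toFinset

theorem card_visited_le (h : History n) : (visited h).card ≤ h.length :=
  (List.toFinset_card_le _).trans (List.length_filterMap_le _ _)

theorem mem_visited_of_deg {h : History n} {v : Fin n} {a : Answer n}
    (hv : (Query.deg v, a) ∈ h) : v ∈ visited h := by
  rw [visited, List.mem_toFinset, List.mem_filterMap]
  exact ⟨_, hv, rfl⟩

theorem mem_visited_of_neigh {h : History n} {v : Fin n} {a : Answer n}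
    (hv : (Query.neigh v, a) ∈ h) : v ∈ visited h := by
  rw [visited, List.mem_toFinset, List.mem_filterMap]
  exact ⟨_, hv, rfl⟩

variable {blk : Fin (k + 1) × Fin b ↪ Fin n} {M : SimpleGraph (Fin n)}

/-- The class `τ a` of block vertices, completely joined to the class `lam c`. -/
def planted (blk : Fin (k + 1) × Fin b ↪ Fin n) (M : SimpleGraph (Fin n))
    (τ : Fin A × Fin t ↪ Fin (k + 1) × Fin b) (lam : Fin B × Fin l ↪ Fin n)
    (i : (Fin (k + 1) → Fin b) × Fin A × Fin B) : SimpleGraph (Fin n) :=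
  hiddenClique blk M i.1 ⊔ biclique (classSet (τ.trans blk) i.2.1) (classSet lam i.2.2)

variable {τ : Fin A × Fin t ↪ Fin (k + 1) × Fin b} {lam : Fin B × Fin l ↪ Fin n} {D : DetAlg n}

theorem exposed_or_visited_of_distinguishing {x : Fin (k + 1) → Fin b} {a : Fin A} {c : Fin B}
    {s : List (Fin k)}
    (h : seedRun D blk M x s ∈
      distinguishing (hiddenClique blk M x) (planted blk M τ lam (x, a, c))) :
    (∃ p ∈ exposed blk (seedRun D blk M x s), p ∈ classSet τ a) ∨
      ∃ v ∈ visited (seedRun D blk M x s), v ∈ classSet lam c := by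
  obtain ⟨⟨q, ans⟩, he, hne⟩ := h
  by_contra! hcon
  obtain ⟨h1, h2⟩ := hcon
  have hT : ∀ v, (∀ p, blk p = v → p ∈ exposed blk (seedRun D blk M x s)) →
      v ∉ classSet (τ.trans blk) a := by
    rintro v hv ⟨i, rfl⟩
    exact h1 _ (hv _ rfl) ⟨i, rfl⟩
  refine hne (oracle_eq_sup_biclique _ ?_ ?_ ?_)
  · rintro v rfl
    exact ⟨hT v fun p hp => mem_exposed.mpr ⟨_, he, hp⟩, h2 v (mem_visited_of_deg he)⟩
  · rintro v rfl
    exact ⟨hT v fun p hp => mem_exposed.mpr ⟨_, he, hp⟩, h2 v (mem_visited_of_neigh he)⟩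
  · rintro S rfl hS v hv
    refine hT v fun p hp => mem_exposed.mpr ⟨_, he, ?_, hp ▸ hv⟩
    obtain ⟨r, hr⟩ := exists_seed_of_mem_seedRun he
    simpa [seedAnswer, hS] using hr

/-- Three failures of proportion at most 1/36 each: a choice `x` with many exposed vertices, a class
of `τ` containing an exposed vertex, a class of `lam` containing a visited one. -/
theorem ncard_distinguishing_planted_le (hM : IsSideMatching blk M) {q : ℕ} (hq : 0 < q)
    (hb : 0 < b) (hA : 36 * (12 * q * b) ≤ A) (hB : 36 * q ≤ B) {s : List (Fin k)}
    (hs : s.length = q) :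
    12 * {i : (Fin (k + 1) → Fin b) × Fin A × Fin B | seedRun D blk M i.1 s ∈
      distinguishing (hiddenClique blk M i.1) (planted blk M τ lam i)}.ncard ≤
        b ^ (k + 1) * (A * B) := by
  classical
  let P : (Fin (k + 1) → Fin b) × Fin A × Fin B → Prop := fun i => seedRun D blk M i.1 s ∈
    distinguishing (hiddenClique blk M i.1) (planted blk M τ lam i)
  let F : (Fin (k + 1) → Fin b) → Prop := fun x =>
    12 * q * b ≤ (exposed blk (seedRun D blk M x s)).card
  have hF : 36 * (Finset.univ.filter F).card ≤ b ^ (k + 1) := card_many_exposed_le hM hq hb hs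
  have hx : ∀ x, {y : Fin A × Fin B | P (x, y)}.ncard ≤
      (if F x then A * B else 0) + (12 * q * b * B + A * q) := by
    intro x
    by_cases hFx : F x
    · rw [if_pos hFx]
      refine le_trans ?_ le_self_add
      refine (Set.ncard_le_ncard (Set.subset_univ _)).trans ?_
      rw [Set.ncard_univ]
      simp
    · rw [if_neg hFx, zero_add]
      have hsub : {y : Fin A × Fin B | P (x, y)} ⊆
          {a | ∃ p ∈ exposed blk (seedRun D blk M x s), p ∈ classSet τ a} ×ˢ Set.univ ∪
            Set.univ ×ˢ {c | ∃ v ∈ visited (seedRun D blk M x s), v ∈ classSet lam c} := by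
        rintro ⟨a, c⟩ h
        rcases exposed_or_visited_of_distinguishing h with h | h
        · exact .inl ⟨h, Set.mem_univ _⟩
        · exact .inr ⟨Set.mem_univ _, h⟩
      refine (Set.ncard_le_ncard hsub).trans ((Set.ncard_union_le _ _).trans ?_)
      rw [Set.ncard_prod, Set.ncard_prod, Set.ncard_univ, Set.ncard_univ, Nat.card_eq_fintype_card,
        Nat.card_eq_fintype_card, Fintype.card_fin, Fintype.card_fin]
      have h1 := ncard_classSet_inter_nonempty_le τ (exposed blk (seedRun D blk M x s))
      have h2 := ncard_classSet_inter_nonempty_le lam (visited (seedRun D blk M x s))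
      have h3 := (card_visited_le (seedRun D blk M x s)).trans (length_seedRun_le x s)
      gcongr
      · exact h1.trans (not_le.mp hFx).le
      · exact h2.trans (h3.trans hs.le)
  have hsum : {i | P i}.ncard = ∑ x, {y : Fin A × Fin B | P (x, y)}.ncard := by
    have h1 : ∀ x, {y : Fin A × Fin B | P (x, y)}.ncard =
        ∑ y, if P (x, y) then 1 else 0 := by
      intro x
      rw [← Finset.card_filter, ← Set.ncard_coe_finset]
      simp
    rw [Finset.sum_congr rfl fun x _ => h1 x, ← Fintype.sum_prod_type (fun i => if P i then 1 else 0),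
      ← Finset.card_filter, ← Set.ncard_coe_finset]
    simp
  have htotal : {i | P i}.ncard ≤
      (Finset.univ.filter F).card * (A * B) + b ^ (k + 1) * (12 * q * b * B + A * q) := by
    rw [hsum]
    refine (Finset.sum_le_sum fun x _ => hx x).trans ?_
    rw [Finset.sum_add_distrib, ← Finset.sum_filter, Finset.sum_const, Finset.sum_const]
    simp
  have h36 : 36 * (12 * q * b * B + A * q) ≤ 2 * (A * B) := by
    have h1 := Nat.mul_le_mul_right B hA
    have h2 := Nat.mul_le_mul_left A hB
    linarith
  have h4 := Nat.mul_le_mul_right (A * B) hF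
  have h5 := Nat.mul_le_mul_left (b ^ (k + 1)) h36
  change 12 * {i | P i}.ncard ≤ _
  linarith

theorem sum_distinguishing_planted_le [Nonempty (Fin k)] (hM : IsSideMatching blk M) {q : ℕ}
    (hq : 0 < q) (hb : 0 < b) (hA : 36 * (12 * q * b) ≤ A) (hB : 36 * q ≤ B) :
    ∑ i : (Fin (k + 1) → Fin b) × Fin A × Fin B,
      (run D (hiddenClique blk M i.1) q).toOuterMeasure
        (distinguishing (hiddenClique blk M i.1) (planted blk M τ lam i)) ≤
      (Fintype.card ((Fin (k + 1) → Fin b) × Fin A × Fin B) : ℝ≥0∞) / 12 := by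
  simp only [run_hiddenClique hM, PMF.toOuterMeasure_map_apply]
  refine sum_toOuterMeasure_le _ _ fun s hs => ?_
  rw [ENNReal.le_div_iff_mul_le (by simp) (by simp), mul_comm]
  have := ncard_distinguishing_planted_le (D := D) (τ := τ) (lam := lam) hM hq hb hA hB
    (length_of_mem_support_seedLaw hs)
  have hcard : Fintype.card ((Fin (k + 1) → Fin b) × Fin A × Fin B) = b ^ (k + 1) * (A * B) := by
    simp
  rw [hcard]
  exact_mod_cast this

/-- The matching with edges between `e (i, false)` and `e (i, true)`. -/
def sideMatching {r : ℕ} (e : Fin r × Bool ↪ Fin n) : SimpleGraph (Fin n) where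
  Adj u v := ∃ i β, e (i, β) = u ∧ e (i, !β) = v
  symm := ⟨by
    rintro _ _ ⟨i, β, rfl, rfl⟩
    exact ⟨i, !β, rfl, by rw [Bool.not_not]⟩⟩
  loopless := ⟨by
    rintro v ⟨i, β, h1, h2⟩
    have := (Prod.mk.inj (e.injective (h1.trans h2.symm))).2
    revert this
    cases β <;> simp⟩

theorem ncard_edgeSet_sideMatching {r : ℕ} (e : Fin r × Bool ↪ Fin n) :
    (sideMatching e).edgeSet.ncard = r := by
  have h : (sideMatching e).edgeSet = Set.range fun i => s(e (i, false), e (i, true)) := by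
    ext z
    induction z with
    | _ u v =>
      rw [SimpleGraph.mem_edgeSet]
      constructor
      · rintro ⟨i, β, rfl, rfl⟩
        refine ⟨i, ?_⟩
        cases β
        · rfl
        · exact Sym2.eq_swap
      · rintro ⟨i, hi⟩
        rcases Sym2.eq_iff.mp hi with ⟨rfl, rfl⟩ | ⟨rfl, rfl⟩
        · exact ⟨i, false, rfl, rfl⟩
        · exact ⟨i, true, rfl, rfl⟩
  have hinj : Function.Injective fun i => s(e (i, false), e (i, true)) := by
    intro i j hij
    rcases Sym2.eq_iff.mp hij with ⟨h1, -⟩ | ⟨h1, -⟩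
    · exact (Prod.mk.inj (e.injective h1)).1
    · exact (Prod.mk.inj (e.injective h1)).1
  rw [h, ← Set.image_univ, Set.ncard_image_of_injective _ hinj, Set.ncard_univ]
  simp

theorem exists_le_expectedQueries_of_planting {Ω : Type*} [MeasurableSpace Ω]
    (μ : MeasureTheory.Measure Ω) [MeasureTheory.IsProbabilityMeasure μ] (Alg : RandAlg n Ω)
    {ε : ℝ} (hAlg : Alg.EstimatesEdges μ ε) {m r q : ℕ} (hk : 0 < k)
    (hm : (k + 1).choose 2 + r = m)
    (hq : 0 < q) (hb : 0 < b) (hB : 36 * q ≤ B)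
    (ht : 36 * (12 * q) * t ≤ k + 1)
    (hn : (k + 1) * b + B * l + r * 2 ≤ n) (hε1 : ε < 1)
    (hgap : (1 + ε) * m < (1 - ε) * (m + t * l)) :
    ∃ G : SimpleGraph (Fin n), G.edgeSet.ncard = m ∧
      ((q : ℝ≥0∞) + 1) / 4 ≤ Alg.expectedQueries μ G := by
  obtain ⟨f⟩ : Nonempty (((Fin (k + 1) × Fin b) ⊕ (Fin B × Fin l)) ⊕ (Fin r × Bool) ↪ Fin n) :=
    Function.Embedding.nonempty_of_card_le (by simpa using hn)
  let blk : Fin (k + 1) × Fin b ↪ Fin n :=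
    (Function.Embedding.inl.trans Function.Embedding.inl).trans f
  let lam : Fin B × Fin l ↪ Fin n :=
    (Function.Embedding.inr.trans Function.Embedding.inl).trans f
  let e : Fin r × Bool ↪ Fin n := Function.Embedding.inr.trans f
  let M := sideMatching e
  obtain ⟨τ⟩ : Nonempty (Fin (36 * (12 * q * b)) × Fin t ↪ Fin (k + 1) × Fin b) := by
    refine Function.Embedding.nonempty_of_card_le ?_
    simp only [Fintype.card_prod, Fintype.card_fin]
    calc 36 * (12 * q * b) * t = 36 * (12 * q) * t * b := by ring
      _ ≤ _ := by gcongr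
  have hM : IsSideMatching blk M := by
    constructor
    · rintro _ _ _ ⟨i, β, rfl, rfl⟩ ⟨j, γ, h1, rfl⟩
      obtain ⟨rfl, rfl⟩ := Prod.mk.inj (e.injective h1)
      rfl
    · rintro p v ⟨i, β, h, -⟩
      have : Sum.inr (i, β) = Sum.inl (Sum.inl p) := f.injective h
      simp at this
  have hcard : ∀ x, (hiddenClique blk M x).edgeSet.ncard = m := by
    intro x
    rw [ncard_edgeSet_hiddenClique hM, ncard_edgeSet_sideMatching, hm]
  have hlam : ∀ c p, lam c ≠ blk p := by
    intro c p h
    have : (Sum.inl (Sum.inr c) : ((Fin (k + 1) × Fin b) ⊕ (Fin B × Fin l)) ⊕ (Fin r × Bool)) =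
      Sum.inl (Sum.inl p) := f.injective h
    simp at this
  have hlamM : ∀ c u, ¬ M.Adj (lam c) u := by
    rintro c v ⟨i, β, h, -⟩
    have : Sum.inr (i, β) = Sum.inl (Sum.inr c) := f.injective h
    simp at this
  have hplanted : ∀ i : (Fin (k + 1) → Fin b) × Fin (36 * (12 * q * b)) × Fin B,
      m + t * l ≤ (planted blk M τ lam i).edgeSet.ncard := by
    rintro ⟨x, a, c⟩
    let T : Fin t ↪ Fin n := ⟨fun i => blk (τ (a, i)), fun i j h =>
      (Prod.mk.inj (τ.injective (blk.injective h))).2⟩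
    let L : Fin l ↪ Fin n := ⟨fun i => lam (c, i), fun i j h =>
      (Prod.mk.inj (lam.injective h)).2⟩
    rw [← hcard x]
    refine le_ncard_edgeSet_sup_biclique (T := T) (L := L) _ (fun i j h => hlam _ _ h.symm) ?_
    intro j u
    rw [hiddenClique_adj_of_notMem_range]
    · exact hlamM _ u
    · rintro ⟨p, hp⟩
      exact hlam _ _ hp.symm
  have hdisj : ∀ i : (Fin (k + 1) → Fin b) × Fin (36 * (12 * q * b)) × Fin B, Disjoint
      (Set.Icc ((1 - ε) * ((hiddenClique blk M i.1).edgeSet.ncard : ℝ))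
        ((1 + ε) * ((hiddenClique blk M i.1).edgeSet.ncard : ℝ)))
      (Set.Icc ((1 - ε) * ((planted blk M τ lam i).edgeSet.ncard : ℝ))
        ((1 + ε) * ((planted blk M τ lam i).edgeSet.ncard : ℝ))) := by
    intro i
    rw [Set.disjoint_left]
    intro z hz hz'
    have h1 : ((m : ℝ) + t * l) ≤ ((planted blk M τ lam i).edgeSet.ncard : ℝ) := by
      exact_mod_cast hplanted i
    have h2 := mul_le_mul_of_nonneg_left h1 (sub_nonneg.mpr hε1.le)
    rw [hcard] at hz
    linarith [hz.2, hz'.1]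
  have hk' : Nonempty (Fin k) := ⟨⟨0, hk⟩⟩
  have hne : Nonempty ((Fin (k + 1) → Fin b) × Fin (36 * (12 * q * b)) × Fin B) :=
    ⟨fun _ => ⟨0, hb⟩, ⟨0, by positivity⟩, ⟨0, by omega⟩⟩
  obtain ⟨i, hi⟩ := Alg.exists_le_expectedQueries μ
    (fun i : (Fin (k + 1) → Fin b) × Fin (36 * (12 * q * b)) × Fin B => hiddenClique blk M i.1)
    (fun i => planted blk M τ lam i) _ _ hdisj (fun _ => hAlg _) (fun _ => hAlg _) q
    fun _ => sum_distinguishing_planted_le hM hq hb le_rfl hB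
  exact ⟨_, hcard i.1, hi⟩

end Planting

/-! ### Choice of parameters in the two cases. -/

section Parameters

/-- Comparison with the empty graph after zero rounds; it covers the range where the claimed bound
is at most 1/4. -/
theorem exists_one_fourth_le_expectedQueries {n : ℕ} {Ω : Type*} [MeasurableSpace Ω]
    (μ : MeasureTheory.Measure Ω) [MeasureTheory.IsProbabilityMeasure μ] (A : RandAlg n Ω)
    {ε : ℝ} (hε : ε < 1) (hA : A.EstimatesEdges μ ε) {m : ℕ} (hm0 : 0 < m)
    (hm : m ≤ n.choose 2) :
    ∃ G : SimpleGraph (Fin n), G.edgeSet.ncard = m ∧ 1 / 4 ≤ A.expectedQueries μ G := by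
  obtain ⟨G, -, hG⟩ := exists_ge_ncard_edgeSet_eq (⊥ : SimpleGraph (Fin n)) (by simp) hm
  have hdisj : ∀ _ : Unit, Disjoint
      (Set.Icc ((1 - ε) * (G.edgeSet.ncard : ℝ)) ((1 + ε) * (G.edgeSet.ncard : ℝ)))
      (Set.Icc ((1 - ε) * ((⊥ : SimpleGraph (Fin n)).edgeSet.ncard : ℝ))
        ((1 + ε) * ((⊥ : SimpleGraph (Fin n)).edgeSet.ncard : ℝ))) := by
    intro _
    rw [Set.disjoint_left]
    intro x hx hx'
    rw [hG] at hx
    have h1 : x ≤ 0 := by simpa using hx'.2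
    have h2 : 0 < (1 - ε) * (m : ℝ) := mul_pos (by linarith) (by exact_mod_cast hm0)
    linarith [hx.1]
  obtain ⟨_, h⟩ := A.exists_le_expectedQueries μ (fun _ : Unit => G) (fun _ => ⊥) _ _ hdisj
    (fun _ => hA _) (fun _ => hA _) 0 fun B => by
      simp [run, PMF.toOuterMeasure_pure_apply, distinguishing]
  exact ⟨G, hG, by simpa using h⟩

theorem exists_choose_two_le_lt {m : ℕ} (hm : 0 < m) :
    ∃ k, 0 < k ∧ (k + 1).choose 2 ≤ m ∧ m < (k + 2).choose 2 := by
  have hex : ∃ j, m < (j + 2).choose 2 := ⟨m, by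
    have h1 := Nat.choose_succ_succ (m + 1) 1
    simp only [Nat.choose_one_right] at h1
    have : (m + 2).choose 2 = (m + 1) + (m + 1).choose 2 := h1
    omega⟩
  classical
  refine ⟨Nat.find hex, ?_, ?_, Nat.find_spec hex⟩
  · rw [Nat.find_pos]
    simpa [Nat.pos_iff_ne_zero] using hm.ne'
  · rcases h : Nat.find hex with _ | j
    · simp
    · exact not_lt.mp (Nat.find_min hex (m := j) (by omega))

theorem half_le_floor_div {a d : ℕ} (hd : 0 < d) (h : d ≤ a) :
    (a : ℝ) / (2 * d) ≤ ((a / d : ℕ) : ℝ) := by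
  have h1 : 1 ≤ a / d := (Nat.one_le_div_iff hd).mpr h
  have h2 : a < d * (a / d + 1) := Nat.lt_mul_div_succ a hd
  have h3 : a ≤ a / d * (2 * d) := by nlinarith
  rw [div_le_iff₀ (by positivity)]
  exact_mod_cast h3

variable {n m k q : ℕ} {ε δ : ℝ}

/-- The estimates on `q` that both constructions use. -/
structure Admissible (n m k q : ℕ) (ε δ : ℝ) : Prop where
  eps_pos : 0 < ε
  delta_pos : 0 < δ
  delta_le : δ ≤ 1 - ε
  k_pos : 0 < k
  q_pos : 0 < q
  choose_le : (k + 1).choose 2 ≤ m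
  lt_choose : m < (k + 2).choose 2
  le_size : 1000 * q ≤ k + 1
  sq_le : 10 ^ 6 * ((q : ℝ) ^ 2 * (ε * √m)) ≤ δ * n
  sqrt_le : √(m : ℝ) ≤ k + 1

theorem Admissible.removal_gap (h : Admissible n m k q ε δ) (hn : n < 6 * (k + 1)) {m' : ℕ}
    (hm' : m' + ((k + 1) / (12 * q)).choose 2 = m) : (1 + ε) * m' < (1 - ε) * m := by
  obtain ⟨hε, hδ, hδε, -, hq, -, -, hkq, hsq, hsqrt⟩ := h
  set z := (k + 1) / (12 * q) with hz
  have hz2 : 2 ≤ z := by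
    rw [hz, Nat.le_div_iff_mul_le (by omega)]
    omega
  have hq' : (0 : ℝ) < q := by exact_mod_cast hq
  have hz1 : ((k : ℝ) + 1) / (24 * q) ≤ z := by
    have := half_le_floor_div (a := k + 1) (d := 12 * q) (by omega) (by omega)
    push_cast at this
    rwa [show (2 * (12 * (q : ℝ))) = 24 * q by ring] at this
  rw [div_le_iff₀ (by positivity)] at hz1
  have hz2' : (2 : ℝ) ≤ z := by exact_mod_cast hz2
  have hC : (z : ℝ) ^ 2 / 4 ≤ (z.choose 2 : ℝ) := by
    rw [Nat.cast_choose_two]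
    nlinarith
  have hmm : (m' : ℝ) + (z.choose 2 : ℝ) = m := by exact_mod_cast hm'
  have hs : √(m : ℝ) * √(m : ℝ) = m := Real.mul_self_sqrt (Nat.cast_nonneg m)
  have hs0 := Real.sqrt_nonneg (m : ℝ)
  set σ := √(m : ℝ)
  have hn' : (n : ℝ) ≤ 6 * (k + 1) := by exact_mod_cast hn.le
  have hk0 : (0 : ℝ) < (k : ℝ) + 1 := by positivity
  have h1 : 10 ^ 6 * ((q : ℝ) ^ 2 * (ε * σ)) ≤ 6 * (k + 1) := by
    refine hsq.trans ?_
    nlinarith [Nat.cast_nonneg (α := ℝ) n]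
  have h2 : 10 ^ 6 * ((q : ℝ) ^ 2 * (ε * m)) ≤ 6 * ((k : ℝ) + 1) ^ 2 := by
    calc 10 ^ 6 * ((q : ℝ) ^ 2 * (ε * m)) = (10 ^ 6 * ((q : ℝ) ^ 2 * (ε * σ))) * σ := by
          rw [← hs]; ring
      _ ≤ (6 * ((k : ℝ) + 1)) * ((k : ℝ) + 1) := by gcongr
      _ = _ := by ring
  have h3 : ((k : ℝ) + 1) ^ 2 ≤ 576 * ((q : ℝ) ^ 2 * z ^ 2) := by
    calc ((k : ℝ) + 1) ^ 2 ≤ (z * (24 * q)) ^ 2 := by gcongr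
      _ = _ := by ring
  -- The number of removed edges is of order `((k + 1) / q) ^ 2`, which beats `ε * m` because `n` is
  -- at most `6 * (k + 1)` in `sq_le`.
  have h4 : 2 * (ε * m) < (z.choose 2 : ℝ) := by
    have hpos : 0 < (q : ℝ) ^ 2 * z ^ 2 := by positivity
    have h5 : (q : ℝ) ^ 2 * (2 * (ε * m)) < (q : ℝ) ^ 2 * (z ^ 2 / 4) := by linarith
    exact (lt_of_mul_lt_mul_left h5 (by positivity)).trans_le hC
  have h6 : 0 ≤ ε * (z.choose 2 : ℝ) := by positivity
  have h7 : (m' : ℝ) = m - z.choose 2 := by linarith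
  rw [h7]
  linarith

theorem Admissible.planting_gap (h : Admissible n m k q ε δ) (hn : 6 * (k + 1) ≤ n) :
    (1 + ε) * m < (1 - ε) *
      (m + (((k + 1) / (36 * (12 * q)) : ℕ) : ℝ) * ((n / 3 / (36 * q) : ℕ) : ℝ)) := by
  obtain ⟨hε, hδ, hδε, hk, hq, -, -, hkq, hsq, hsqrt⟩ := h
  have hq' : (0 : ℝ) < q := by exact_mod_cast hq
  have ht := half_le_floor_div (a := k + 1) (d := 36 * (12 * q)) (by omega) (by omega)
  have hl := half_le_floor_div (a := n / 3) (d := 36 * q) (by omega) (by omega)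
  have hn3 : (n : ℝ) / 4 ≤ ((n / 3 : ℕ) : ℝ) := by
    have : n ≤ n / 3 * 4 := by omega
    rw [div_le_iff₀ (by norm_num)]
    exact_mod_cast this
  set t := (k + 1) / (36 * (12 * q))
  set l := n / 3 / (36 * q)
  push_cast at ht hl
  rw [div_le_iff₀ (by positivity)] at ht hl
  have hs : √(m : ℝ) * √(m : ℝ) = m := Real.mul_self_sqrt (Nat.cast_nonneg m)
  have hs0 := Real.sqrt_nonneg (m : ℝ)
  set σ := √(m : ℝ)
  have hk0 : (0 : ℝ) < (k : ℝ) + 1 := by positivity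
  have hn0 : (0 : ℝ) < n := by
    have : 0 < n := by omega
    exact_mod_cast this
  have h1 : 10 ^ 6 * ((q : ℝ) ^ 2 * (ε * m)) ≤ δ * (n * (k + 1)) := by
    calc 10 ^ 6 * ((q : ℝ) ^ 2 * (ε * m)) = (10 ^ 6 * ((q : ℝ) ^ 2 * (ε * σ))) * σ := by
          rw [← hs]; ring
      _ ≤ δ * n * (k + 1) := by gcongr
      _ = _ := by ring
  have hl' : (n : ℝ) ≤ l * (288 * q) := by linarith
  have h2 : (n : ℝ) * (k + 1) ≤ 248832 * ((q : ℝ) ^ 2 * (t * l)) := by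
    calc (n : ℝ) * (k + 1) ≤ (l * (288 * q)) * (t * (2 * (36 * (12 * q)))) := by gcongr
      _ = _ := by ring
  have htl : 0 < (q : ℝ) ^ 2 * (t * l) := by
    have : 0 < (n : ℝ) * (k + 1) := by positivity
    linarith
  -- Here `t * l` is of order `n * (k + 1) / q ^ 2`; the factor `δ ≤ 1 - ε` keeps the gap open for
  -- `ε` near 1.
  have h3 : 2 * (ε * m) < δ * (t * l) := by
    have h5 : (q : ℝ) ^ 2 * (2 * (ε * m)) < (q : ℝ) ^ 2 * (δ * (t * l)) := by
      have h6 := mul_le_mul_of_nonneg_left h2 hδ.le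
      have h7 : 0 < δ * ((q : ℝ) ^ 2 * (t * l)) := mul_pos hδ htl
      linarith
    exact lt_of_mul_lt_mul_left h5 (by positivity)
  have h4 : δ * ((t : ℝ) * l) ≤ (1 - ε) * (t * l) := by gcongr
  linarith

theorem Admissible.exists_le_expectedQueries (h : Admissible n m k q ε δ) (hm : m ≤ n.choose 2)
    {Ω : Type*} [MeasurableSpace Ω] (μ : MeasureTheory.Measure Ω)
    [MeasureTheory.IsProbabilityMeasure μ] (A : RandAlg n Ω) (hA : A.EstimatesEdges μ ε) :
    ∃ G : SimpleGraph (Fin n), G.edgeSet.ncard = m ∧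
      ((q : ℝ≥0∞) + 1) / 4 ≤ A.expectedQueries μ G := by
  have hq := h.q_pos
  have hkq := h.le_size
  have hchoose : (k + 2).choose 2 = (k + 1) + (k + 1).choose 2 := by
    have h1 := Nat.choose_succ_succ (k + 1) 1
    rwa [Nat.choose_one_right] at h1
  rcases lt_or_ge n (6 * (k + 1)) with hn | hn
  · have hsn : k + 1 ≤ n := by
      by_contra! hlt
      have h1 : (n + 1).choose 2 ≤ (k + 1).choose 2 := Nat.choose_le_choose 2 (by omega)
      have h2 : (n + 1).choose 2 = n + n.choose 2 := by
        have h1 := Nat.choose_succ_succ n 1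
        rwa [Nat.choose_one_right] at h1
      have h3 := h.choose_le
      -- The binomials `n.choose 2` and `(n + 1).choose 2` differ by `n`, so they coincide only for
      -- `n = 0`.
      have h4 : n = 0 := by omega
      subst h4
      have h5 : 0 < (k + 1).choose 2 := Nat.choose_pos (by omega)
      simp at hm
      omega
    exact exists_le_expectedQueries_of_removal μ A hA hm hsn h.choose_le (by omega)
      (Nat.mul_div_le (k + 1) (12 * q)) le_rfl fun m' hm' => h.removal_gap hn hm'
  · have hlt := h.lt_choose
    have hle := h.choose_le
    refine exists_le_expectedQueries_of_planting (r := m - (k + 1).choose 2)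
      (b := n / 3 / (k + 1)) (B := 36 * q) (t := (k + 1) / (36 * (12 * q)))
      (l := n / 3 / (36 * q)) μ A hA h.k_pos (by omega) hq ?_ le_rfl (Nat.mul_div_le _ _) ?_
      (by linarith [h.delta_pos, h.delta_le]) (h.planting_gap hn)
    · exact Nat.div_pos (by omega) (by omega)
    -- One third of the vertices serves the blocks, one the classes of `lam`, one the matching,
    -- which has at most `k` edges.
    · have h1 := Nat.mul_div_le (n / 3) (k + 1)
      have h2 := Nat.mul_div_le (n / 3) (36 * q)
      omega

end Parameters

end HybridModel

theorem mainTheorem3 (ε₀ : ℝ) (hε₀ : ε₀ < 1) :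
    ∃ c : ℝ, 0 < c ∧
      ∀ (ε : ℝ), 0 < ε → ε ≤ ε₀ →
      ∀ (n : ℕ) {Ω : Type*} [MeasurableSpace Ω] (μ : MeasureTheory.Measure Ω)
        [MeasureTheory.IsProbabilityMeasure μ] (A : HybridModel.RandAlg n Ω),
        A.EstimatesEdges μ ε →
        ∀ m : ℕ, m ≤ n.choose 2 →
          ∃ G : SimpleGraph (Fin n), G.edgeSet.ncard = m ∧
            ENNReal.ofReal (c * min (√(m : ℝ)) (√((n : ℝ) / (ε * √(m : ℝ)))))
              ≤ A.expectedQueries μ G := by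
  have hδ : 0 < 1 - ε₀ := sub_pos.mpr hε₀
  -- The 4 is the loss in `(q + 1) / 4`; the rest is `c₁`, with `10 ^ 6 * c₁ ^ 2 = 1 - ε₀` as
  -- `sq_le` demands.
  refine ⟨√(1 - ε₀) / 1000 / 4, by positivity, ?_⟩
  intro ε hε hεε₀ n Ω _ μ _ A hA m hm
  rcases Nat.eq_zero_or_pos m with rfl | hm0
  -- For `m = 0` the minimum is 0.
  · exact ⟨⊥, by simp, by simp⟩
  set τ := min (√(m : ℝ)) (√((n : ℝ) / (ε * √(m : ℝ)))) with hτ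
  set c₁ := √(1 - ε₀) / 1000 with hc₁
  have hτ0 : 0 ≤ τ := le_min (Real.sqrt_nonneg _) (Real.sqrt_nonneg _)
  have hσ : 0 < √(m : ℝ) := Real.sqrt_pos.mpr (by exact_mod_cast hm0)
  have hc0 : 0 ≤ c₁ := by positivity
  have hc1 : c₁ ≤ 1 / 1000 := by
    rw [hc₁]
    gcongr
    exact Real.sqrt_le_one.mpr (by linarith)
  have hc2 : 10 ^ 6 * c₁ ^ 2 = 1 - ε₀ := by
    rw [hc₁, div_pow, Real.sq_sqrt hδ.le]
    ring
  have hfloor : c₁ * τ < (⌊c₁ * τ⌋₊ : ℝ) + 1 := Nat.lt_floor_add_one _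
  have hfloor' : (⌊c₁ * τ⌋₊ : ℝ) ≤ c₁ * τ := Nat.floor_le (by positivity)
  set q := ⌊c₁ * τ⌋₊
  have hbound : ENNReal.ofReal (c₁ / 4 * τ) ≤ ((q : ℝ≥0∞) + 1) / 4 := by
    have : ((q : ℝ≥0∞) + 1) / 4 = ENNReal.ofReal (((q : ℝ) + 1) / 4) := by
      rw [ENNReal.ofReal_div_of_pos (by norm_num), ENNReal.ofReal_add (by positivity) (by norm_num)]
      simp
    rw [this]
    exact ENNReal.ofReal_le_ofReal (by linarith)
  rcases Nat.eq_zero_or_pos q with hq | hq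
  · obtain ⟨G, hG, h⟩ := HybridModel.exists_one_fourth_le_expectedQueries μ A
      (hεε₀.trans_lt hε₀) hA hm0 hm
    refine ⟨G, hG, hbound.trans (le_trans (le_of_eq ?_) h)⟩
    simp [hq]
  · obtain ⟨k, hk, hle, hlt⟩ := HybridModel.exists_choose_two_le_lt hm0
    have hsqrt : √(m : ℝ) ≤ k + 1 := by
      rw [Real.sqrt_le_left (by positivity)]
      have h1 : (m : ℝ) ≤ ((k + 2).choose 2 : ℕ) := by exact_mod_cast hlt.le
      rw [Nat.cast_choose_two] at h1
      push_cast at h1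
      nlinarith [Nat.cast_nonneg (α := ℝ) k]
    have hadm : HybridModel.Admissible n m k q ε (1 - ε₀) := by
      refine ⟨hε, hδ, by linarith, hk, hq, hle, hlt, ?_, ?_, hsqrt⟩
      · have h1 : c₁ * τ ≤ 1 / 1000 * (k + 1) :=
          mul_le_mul hc1 ((min_le_left _ _).trans hsqrt) hτ0 (by norm_num)
        have h2 : (1000 * q : ℝ) ≤ k + 1 := by linarith
        exact_mod_cast h2
      · have h1 : τ ^ 2 ≤ n / (ε * √(m : ℝ)) := by
          rw [← Real.sq_sqrt (show 0 ≤ (n : ℝ) / (ε * √(m : ℝ)) by positivity)]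
          gcongr
          exact min_le_right _ _
        rw [le_div_iff₀ (by positivity)] at h1
        calc 10 ^ 6 * ((q : ℝ) ^ 2 * (ε * √(m : ℝ)))
            ≤ 10 ^ 6 * ((c₁ * τ) ^ 2 * (ε * √(m : ℝ))) := by gcongr
          _ = (10 ^ 6 * c₁ ^ 2) * (τ ^ 2 * (ε * √(m : ℝ))) := by ring
          _ ≤ _ := by rw [hc2]; gcongr
    obtain ⟨G, hG, h⟩ := hadm.exists_le_expectedQueries hm μ A hA
    exact ⟨G, hG, hbound.trans h⟩
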